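/- Let $k$ be an algebraically closed field of characteristic $0$, let $V$ be a nonsingular variety over $k$ (a smooth separated $k$-scheme of finite type), let $E$ be a vector bundle of rank $r+1$ on $V$ $(r\ge 0)$ with a section $s$, and let $X=Z(s)\subseteq V$ be the zero-scheme of $s$; that is, writing $\mathscr E$ for the sheaf of sections of $E^\vee$, the image of the evaluation morphism $s^\vee:\mathscr E\to\mathscr O_V$ is the ideal sheaf $\mathscr I_X$ of $X$. Let $\pi:\mathscr V=\mathbb P(E^\vee)\to V$ be the projective bundle of lines in $E^\vee$, let $\mathscr O(-1)\subseteq \pi^*E^\vee$ be its tautological line subbundle, and let $\rho:\mathbb P(E^\vee|_X)=\pi^{-1}(X)\to X$ be the restriction of $\pi$. Let $\phi:E^\vee|_X\to T^*V|_X$ be the morphism corresponding to the composition $\mathscr E|_X\to\mathscr I_X/\mathscr I_X^2\to\Omega_V|_X$ of the morphism induced by $s^\vee$ and the morphism $f\mapsto df$, and let $\mathscr Y\subseteq\mathbb P(E^\vee|_X)\subseteq\mathscr V$ be the zero-scheme of the composition $$\sigma_{\mathscr Y}:\ \mathscr O(-1)\to\rho^*E^\vee|_X\xrightarrow{\ \rho^*\phi\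 }\rho^*T^*V|_X .$$ Let $\epsilon:\pi^*E\to\mathscr O(1)$ be the dual of the inclusion $\mathscr O(-1)\subseteq\pi^*E^\vee$, and let $\mathscr X\subseteq\mathscr V$ be the zero-scheme of the section $\epsilon\circ\pi^*s$ of $\mathscr O(1)$. The singularity (Jacobian) subscheme of $\mathscr X$ is the largest closed subscheme of $\mathscr X$ on which the morphism $\mathscr I_{\mathscr X}/\mathscr I_{\mathscr X}^2\to\Omega_{\mathscr V}|_{\mathscr X}$, $f\mapsto df$, vanishes. Then: 1. $\mathscr Y$ is the singularity subscheme of $\mathscr X$; that is, the two coincide as closed subschemes of $\mathscr V$. 2. Let $U\subseteq V$ be an affine open subset over which $E$ is trivial, let $y_0,\dots,y_r$ be a frame of $E|_U$ (so that $y_0,\dots,y_r$ are homogeneous coordinates on the fibers of $\pi$ over $U$), and write $s|_U=\sum_j f_jy_j$ with $f_j\in\mathscr O_V(U)$. Then $\mathscr X$ is given over $U$ by the equation $\sum_j y_jf_j=0$; that is, for every $i$, the ideal of $\mathscr X$ in the affine chart $\{y_i\neq 0\}$ of $\pi^{-1}(U)$ is generated by $\sum_j f_j\,y_j/y_i$.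 -/

import Mathlib

open AlgebraicGeometry CategoryTheory Limits TensorProduct

universe u

namespace ProjBundle

section Algebra

variable (A : Type u) [CommRing A] (N : Type u) [AddCommGroup N] [Module A N]

/-- The degree `d` part of the symmetric algebra of `N`. -/
noncomputable def gr (d : ℕ) : Submodule A (SymmetricAlgebra A N) :=
  LinearMap.range (SymmetricAlgebra.ι A N) ^ d

theorem iota_mem (l : N) : SymmetricAlgebra.ι A N l ∈ gr A N 1 := by
  simp [gr]

noncomputable instance gr_gradedMonoid : SetLike.GradedMonoid (gr A N) where
  one_mem := by
    change (1 : SymmetricAlgebra A N) ∈ LinearMap.range (SymmetricAlgebra.ι A N) ^ 0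
    rw [pow_zero]
    exact Submodule.one_le.mp le_rfl
  mul_mem i j x y hx hy := by
    change _ ∈ LinearMap.range (SymmetricAlgebra.ι A N) ^ (i + j)
    rw [pow_add]
    exact Submodule.mul_mem_mul hx hy

noncomputable instance gr_gradedAlgebra : GradedAlgebra (gr A N) :=
  GradedAlgebra.ofAlgHom (gr A N)
    (SymmetricAlgebra.lift (DirectSum.lof A ℕ (fun i ↦ gr A N i) 1 ∘ₗ
      (SymmetricAlgebra.ι A N).codRestrict (gr A N 1) (iota_mem A N)))
    (by
      apply SymmetricAlgebra.algHom_ext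
      ext m
      change DirectSum.coeAlgHom (gr A N) (SymmetricAlgebra.lift _ (SymmetricAlgebra.ι A N m)) = _
      rw [SymmetricAlgebra.lift_ι_apply]
      simp only [LinearMap.comp_apply]
      erw [DirectSum.coeAlgHom_of]
      rfl)
    (fun i x ↦ by
      obtain ⟨x, hx⟩ := x
      dsimp only
      change x ∈ LinearMap.range (SymmetricAlgebra.ι A N) ^ i at hx
      induction hx using Submodule.pow_induction_on_left' with
      | algebraMap r => rw [AlgHom.commutes, DirectSum.algebraMap_apply]; rfl
      | add x y i hx hy ihx ihy =>
        rw [map_add, ihx, ihy, ← map_add]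
        rfl
      | mem_mul m hm i x hx ih =>
        obtain ⟨m, rfl⟩ := hm
        rw [map_mul, ih, SymmetricAlgebra.lift_ι_apply]
        simp only [LinearMap.comp_apply]
        erw [DirectSum.of_mul_of]
        exact DirectSum.of_eq_of_gradedMonoid_eq (Sigma.subtype_ext (add_comm _ _) rfl))

variable {A N}
variable {A' : Type u} [CommRing A'] {N' : Type u} [AddCommGroup N'] [Module A' N']

theorem ringHom_ext {R : Type*} [CommRing R] {F G : SymmetricAlgebra A N →+* R}
    (h₀ : ∀ a, F (algebraMap A _ a) = G (algebraMap A _ a))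
    (h₁ : ∀ n, F (SymmetricAlgebra.ι A N n) = G (SymmetricAlgebra.ι A N n)) : F = G := by
  refine RingHom.ext fun x ↦ ?_
  induction x using SymmetricAlgebra.induction with
  | algebraMap r => exact h₀ r
  | ι x => exact h₁ x
  | mul x y hx hy => rw [map_mul, map_mul, hx, hy]
  | add x y hx hy => rw [map_add, map_add, hx, hy]

/-- The ring homomorphism of symmetric algebras induced by a semilinear map. -/
noncomputable def symMap {σ : A' →+* A} (g : N' →ₛₗ[σ] N) :
    SymmetricAlgebra A' N' →+* SymmetricAlgebra A N :=
  letI : Algebra A' (SymmetricAlgebra A N) :=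
    ((algebraMap A (SymmetricAlgebra A N)).comp σ).toAlgebra
  (SymmetricAlgebra.lift (R := A') (M := N') (A := SymmetricAlgebra A N)
    { toFun := fun n ↦ SymmetricAlgebra.ι A N (g n)
      map_add' := by simp
      map_smul' := fun a n ↦ by
        rw [LinearMap.map_smulₛₗ, map_smul, Algebra.smul_def, RingHom.id_apply, Algebra.smul_def]
        rfl }).toRingHom

@[simp] theorem symMap_algebraMap {σ : A' →+* A} (g : N' →ₛₗ[σ] N) (a : A') :
    symMap g (algebraMap A' _ a) = algebraMap A _ (σ a) := by
  let : Algebra A' (SymmetricAlgebra A N) :=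
    ((algebraMap A (SymmetricAlgebra A N)).comp σ).toAlgebra
  exact AlgHom.commutes (SymmetricAlgebra.lift (R := A') (M := N') (A := SymmetricAlgebra A N) _) a

@[simp] theorem symMap_iota {σ : A' →+* A} (g : N' →ₛₗ[σ] N) (n : N') :
    symMap g (SymmetricAlgebra.ι A' N' n) = SymmetricAlgebra.ι A N (g n) := by
  let : Algebra A' (SymmetricAlgebra A N) :=
    ((algebraMap A (SymmetricAlgebra A N)).comp σ).toAlgebra
  exact SymmetricAlgebra.lift_ι_apply (R := A') (M := N') (A := SymmetricAlgebra A N) _ n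

theorem symMap_mem {σ : A' →+* A} (g : N' →ₛₗ[σ] N) {d : ℕ} {x : SymmetricAlgebra A' N'}
    (hx : x ∈ gr A' N' d) : symMap g x ∈ gr A N d := by
  change x ∈ LinearMap.range (SymmetricAlgebra.ι A' N') ^ d at hx
  induction hx using Submodule.pow_induction_on_left' with
  | algebraMap r =>
    rw [symMap_algebraMap]
    exact SetLike.algebraMap_mem_graded (gr A N) _
  | add x y i hx hy ihx ihy => rw [map_add]; exact add_mem ihx ihy
  | mem_mul m hm i x hx ih =>
    obtain ⟨m, rfl⟩ := hm
    rw [map_mul, symMap_iota, Nat.succ_eq_add_one, add_comm]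
    exact SetLike.mul_mem_graded (iota_mem A N _) ih

/-- `symMap` as a homomorphism of graded rings. -/
noncomputable def grMap {σ : A' →+* A} (g : N' →ₛₗ[σ] N) :
    GradedRingHom (gr A' N') (gr A N) where
  __ := symMap g
  map_mem hx := symMap_mem g hx

theorem grMap_apply {σ : A' →+* A} (g : N' →ₛₗ[σ] N) (x) : grMap g x = symMap g x := rfl

theorem irrelevant_le {σ : A' →+* A} (g : N' →ₛₗ[σ] N)
    (hg : Submodule.span A (Set.range g) = ⊤) :
    HomogeneousIdeal.irrelevant (gr A N) ≤
      (HomogeneousIdeal.irrelevant (gr A' N')).map (grMap g) := by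
  rw [HomogeneousIdeal.irrelevant_le]
  set I := ((HomogeneousIdeal.irrelevant (gr A' N')).map (grMap g)).toIdeal with hI
  have h1 : ∀ n : N, SymmetricAlgebra.ι A N n ∈ I := by
    intro n
    have hn : n ∈ Submodule.span A (Set.range g) := by rw [hg]; trivial
    induction hn using Submodule.span_induction with
    | mem x hx =>
      obtain ⟨m, rfl⟩ := hx
      rw [← symMap_iota]
      exact Ideal.mem_map_of_mem _
        (HomogeneousIdeal.mem_irrelevant_of_mem _ one_pos (iota_mem A' N' m))
    | zero => rw [map_zero]; exact I.zero_mem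
    | add x y _ _ hx hy => rw [map_add]; exact I.add_mem hx hy
    | smul a x _ hx => rw [map_smul, Algebra.smul_def]; exact I.mul_mem_left _ hx
  intro d hd x hx
  obtain ⟨d, rfl⟩ := Nat.exists_eq_succ_of_ne_zero hd.ne'
  change x ∈ LinearMap.range (SymmetricAlgebra.ι A N) ^ (d + 1) at hx
  change x ∈ I
  rw [pow_succ] at hx
  induction hx using Submodule.mul_induction_on' with
  | mem_mul_mem m hm n hn =>
    obtain ⟨n, rfl⟩ := hn
    exact I.mul_mem_left _ (h1 n)
  | add x _ y _ hx hy => exact I.add_mem hx hy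


section Localization

variable {ι : Type*} (σ : A' →+* A) (f : A') (g : N' →ₛₗ[σ] N)
  (b' : Module.Basis ι A' N') (b : Module.Basis ι A N)

theorem equiv_symMap (hb : ∀ i, g (b' i) = b i) (x : SymmetricAlgebra A' N') :
    SymmetricAlgebra.equivMvPolynomial b (symMap g x) =
      MvPolynomial.map σ (SymmetricAlgebra.equivMvPolynomial b' x) := by
  suffices h : ((SymmetricAlgebra.equivMvPolynomial b).toRingEquiv.toRingHom.comp (symMap g)) =
      (MvPolynomial.map σ).comp (SymmetricAlgebra.equivMvPolynomial b').toRingEquiv.toRingHom from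
    congr($h x)
  have key : ∀ i, SymmetricAlgebra.equivMvPolynomial b (symMap g (SymmetricAlgebra.ι A' N' (b' i))) =
      MvPolynomial.map σ (SymmetricAlgebra.equivMvPolynomial b' (SymmetricAlgebra.ι A' N' (b' i))) := by
    intro i
    rw [symMap_iota, hb]
    simp
  have key0 : ∀ a, SymmetricAlgebra.equivMvPolynomial b (symMap g (algebraMap A' _ a)) =
      MvPolynomial.map σ (SymmetricAlgebra.equivMvPolynomial b' (algebraMap A' _ a)) := by
    intro a
    rw [symMap_algebraMap, AlgEquiv.commutes, AlgEquiv.commutes, MvPolynomial.algebraMap_eq,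
      MvPolynomial.algebraMap_eq, MvPolynomial.map_C]
  refine ringHom_ext key0 fun n ↦ ?_
  change SymmetricAlgebra.equivMvPolynomial b (symMap g _) =
      MvPolynomial.map σ (SymmetricAlgebra.equivMvPolynomial b' _)
  have hn : n ∈ Submodule.span A' (Set.range b') := by rw [b'.span_eq]; trivial
  induction hn using Submodule.span_induction with
  | mem x hx => obtain ⟨i, rfl⟩ := hx; exact key i
  | zero => simp only [map_zero]
  | add x y _ _ hx hy => simp only [map_add, hx, hy]
  | smul a x _ hx => rw [map_smul, Algebra.smul_def]; simp only [map_mul, key0, hx]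

theorem symMap_surj (hf : letI := σ.toAlgebra; IsLocalization.Away f A)
    (hb : ∀ i, g (b' i) = b i) (x : SymmetricAlgebra A N) :
    ∃ (m : ℕ) (y : SymmetricAlgebra A' N'), algebraMap A _ (σ f) ^ m * x = symMap g y := by
  let : Algebra A' A := σ.toAlgebra
  let : Algebra (MvPolynomial ι A') (MvPolynomial ι A) := (MvPolynomial.map σ).toAlgebra
  have : IsLocalization ((Submonoid.powers f).map (MvPolynomial.C (σ := ι))) (MvPolynomial ι A) :=
    MvPolynomial.isLocalization (Submonoid.powers f) A
  obtain ⟨⟨p, ⟨_, _, ⟨m, rfl⟩, rfl⟩⟩, hp⟩ := IsLocalization.surj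
    ((Submonoid.powers f).map (MvPolynomial.C (σ := ι))) (SymmetricAlgebra.equivMvPolynomial b x)
  refine ⟨m, (SymmetricAlgebra.equivMvPolynomial b').symm p, ?_⟩
  apply (SymmetricAlgebra.equivMvPolynomial b).injective
  rw [equiv_symMap σ g b' b hb, AlgEquiv.apply_symm_apply, map_mul, map_pow, AlgEquiv.commutes,
    mul_comm]
  change _ * MvPolynomial.map σ (MvPolynomial.C (f ^ m)) = MvPolynomial.map σ p at hp
  rw [← hp, MvPolynomial.map_C, map_pow, map_pow, MvPolynomial.algebraMap_eq]

theorem symMap_inj (hf : letI := σ.toAlgebra; IsLocalization.Away f A)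
    (hb : ∀ i, g (b' i) = b i) (y : SymmetricAlgebra A' N') (hy : symMap g y = 0) :
    ∃ m : ℕ, algebraMap A' _ f ^ m * y = 0 := by
  let : Algebra A' A := σ.toAlgebra
  let : Algebra (MvPolynomial ι A') (MvPolynomial ι A) := (MvPolynomial.map σ).toAlgebra
  have : IsLocalization ((Submonoid.powers f).map (MvPolynomial.C (σ := ι))) (MvPolynomial ι A) :=
    MvPolynomial.isLocalization (Submonoid.powers f) A
  have h0 : algebraMap (MvPolynomial ι A') (MvPolynomial ι A)
      (SymmetricAlgebra.equivMvPolynomial b' y) = 0 := by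
    change MvPolynomial.map σ _ = 0
    rw [← equiv_symMap σ g b' b hb, hy, map_zero]
  obtain ⟨⟨_, _, ⟨m, rfl⟩, rfl⟩, hp⟩ := (IsLocalization.map_eq_zero_iff
    ((Submonoid.powers f).map (MvPolynomial.C (σ := ι))) (MvPolynomial ι A) _).mp h0
  refine ⟨m, (SymmetricAlgebra.equivMvPolynomial b').injective ?_⟩
  rw [map_zero, map_mul, map_pow, AlgEquiv.commutes, MvPolynomial.algebraMap_eq, ← map_pow]
  exact hp

/-- The structure map of the affine chart. -/
noncomputable def toAway (A N : Type u) [CommRing A] [AddCommGroup N] [Module A N]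
    (a : SymmetricAlgebra A N) : A →+* HomogeneousLocalization.Away (gr A N) a :=
  (HomogeneousLocalization.fromZeroRingHom (gr A N) (Submonoid.powers a)).comp
    (algebraMap A (gr A N 0))

theorem val_toAway (a : SymmetricAlgebra A N) (c : A) :
    (toAway A N a c).val = algebraMap _ _ (algebraMap A (SymmetricAlgebra A N) c) := by
  simp only [toAway, RingHom.comp_apply]
  rfl

theorem map_toAway (a : SymmetricAlgebra A' N') (c : A') :
    HomogeneousLocalization.Away.map (grMap g) a (toAway A' N' a c) =
      toAway A N (grMap g a) (σ c) := by
  apply HomogeneousLocalization.val_injective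
  rw [val_toAway, ← symMap_algebraMap g]
  change (HomogeneousLocalization.Away.map (grMap g) a (HomogeneousLocalization.mk
    ⟨0, algebraMap A' (gr A' N' 0) c, 1, _⟩)).val = _
  rw [HomogeneousLocalization.Away.map, HomogeneousLocalization.map_mk, HomogeneousLocalization.val_mk,
    ← Localization.mk_one_eq_algebraMap]
  congr 1
  exact Subtype.ext (map_one _)

theorem val_toAway_mul_mk {d n : ℕ} {a : SymmetricAlgebra A N} (ha : a ∈ gr A N d) (c : A)
    (x : SymmetricAlgebra A N) (hx : x ∈ gr A N (n • d)) (m : ℕ) :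
    ((toAway A N a c) ^ m * HomogeneousLocalization.Away.mk (gr A N) ha n x hx).val =
      Localization.mk (algebraMap A _ c ^ m * x) ⟨a ^ n, (⟨n, rfl⟩ : a ^ n ∈ Submonoid.powers a)⟩ := by
  rw [HomogeneousLocalization.val_mul, HomogeneousLocalization.val_pow, val_toAway,
    HomogeneousLocalization.Away.val_mk, ← map_pow, ← Localization.mk_one_eq_algebraMap,
    Localization.mk_mul, one_mul]

theorem isLocalization_away (hf : letI := σ.toAlgebra; IsLocalization.Away f A)
    (hb : ∀ i, g (b' i) = b i) {d : ℕ} (a : SymmetricAlgebra A' N') (ha : a ∈ gr A' N' d) :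
    letI := (HomogeneousLocalization.Away.map (grMap g) a).toAlgebra
    IsLocalization.Away (toAway A' N' a f)
      (HomogeneousLocalization.Away (gr A N) (grMap g a)) := by
  have ha' : grMap g a ∈ gr A N d := symMap_mem g ha
  let := (HomogeneousLocalization.Away.map (grMap g) a).toAlgebra
  refine (isLocalization_iff _ _).mpr ⟨?_, ?_, ?_⟩
  · rintro ⟨_, m, rfl⟩
    let := σ.toAlgebra
    have h : IsUnit (σ f) := IsLocalization.Away.algebraMap_isUnit (S := A) f
    change IsUnit (HomogeneousLocalization.Away.map (grMap g) a _)
    rw [map_pow, map_toAway]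
    exact (h.map _).pow m
  · intro z
    obtain ⟨n, x, hx, rfl⟩ := HomogeneousLocalization.Away.mk_surjective (gr A N) ha' z
    obtain ⟨m, y, hy⟩ := symMap_surj σ f g b' b hf hb x
    let y' := DirectSum.decompose (gr A' N') y (n • d)
    have hy' : symMap g y' = algebraMap A _ (σ f) ^ m * x := by
      have h1 : symMap g y' = DirectSum.decompose (gr A N) (symMap g y) (n • d) :=
        GradedRingHom.map_directSumDecompose (𝒜 := gr A' N') (ℬ := gr A N) (grMap g)
      rw [h1, ← hy]
      apply DirectSum.decompose_of_mem_same
      rw [← map_pow, ← Algebra.smul_def]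
      exact Submodule.smul_mem _ _ hx
    refine ⟨⟨HomogeneousLocalization.Away.mk (gr A' N') ha n y' y'.2, ⟨_, m, rfl⟩⟩, ?_⟩
    change _ * HomogeneousLocalization.Away.map (grMap g) a (_ ^ m) =
      HomogeneousLocalization.Away.map (grMap g) a _
    rw [map_pow, map_toAway, mul_comm]
    apply HomogeneousLocalization.val_injective
    rw [val_toAway_mul_mk, HomogeneousLocalization.Away.map_mk, HomogeneousLocalization.Away.val_mk]
    congr 1
    exact hy'.symm
  · intro z w h
    obtain ⟨z, rfl⟩ : ∃ t, z = t + w := ⟨z - w, by ring⟩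
    obtain ⟨n, x, hx, rfl⟩ := HomogeneousLocalization.Away.mk_surjective (gr A' N') ha z
    rw [map_add, add_eq_right] at h
    change HomogeneousLocalization.Away.map (grMap g) a _ = 0 at h
    have h' := congr(HomogeneousLocalization.val $h)
    rw [HomogeneousLocalization.Away.map_mk, HomogeneousLocalization.Away.val_mk,
      HomogeneousLocalization.val_zero, Localization.mk_eq_mk', IsLocalization.mk'_eq_zero_iff] at h'
    obtain ⟨⟨_, k, rfl⟩, hk⟩ := h'
    have hk' : symMap g (a ^ k * x) = 0 := by rw [map_mul, map_pow]; exact hk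
    obtain ⟨m, hm⟩ := symMap_inj σ f g b' b hf hb _ hk'
    refine ⟨⟨_, m, rfl⟩, ?_⟩
    change toAway A' N' a f ^ m * _ = toAway A' N' a f ^ m * w
    rw [mul_add, add_eq_right]
    apply HomogeneousLocalization.val_injective
    rw [val_toAway_mul_mk, HomogeneousLocalization.val_zero, Localization.mk_eq_mk',
      IsLocalization.mk'_eq_zero_iff]
    refine ⟨⟨_, k, rfl⟩, ?_⟩
    change a ^ k * (algebraMap A' _ f ^ m * x) = 0
    rw [← hm]; ring

variable (A N) in
/-- The structure morphism of `Proj (Sym N)` over `Spec A`. -/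
noncomputable def projToSpec : Proj (gr A N) ⟶ Spec (.of A) :=
  Proj.toSpecZero (gr A N) ≫ Spec.map (CommRingCat.ofHom (algebraMap A (gr A N 0)))

theorem awayι_projToSpec {d : ℕ} (hd : 0 < d) (a : SymmetricAlgebra A N) (ha : a ∈ gr A N d) :
    Proj.awayι (gr A N) a ha hd ≫ projToSpec A N = Spec.map (CommRingCat.ofHom (toAway A N a)) := by
  rw [projToSpec, Proj.awayι_toSpecZero_assoc, ← Spec.map_comp]
  rfl

theorem span_range_eq_top (hb : ∀ i, g (b' i) = b i) : Submodule.span A (Set.range g) = ⊤ := by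
  rw [eq_top_iff, ← b.span_eq, Submodule.span_le]
  rintro _ ⟨i, rfl⟩
  exact Submodule.subset_span ⟨b' i, hb i⟩

theorem isPullback_projMap (hf : letI := σ.toAlgebra; IsLocalization.Away f A)
    (hb : ∀ i, g (b' i) = b i) (hg : Submodule.span A (Set.range g) = ⊤) :
    IsPullback (Proj.map (grMap g) (irrelevant_le g hg)) (projToSpec A N) (projToSpec A' N')
      (Spec.map (CommRingCat.ofHom σ)) := by
  refine Scheme.isPullback_of_openCover _ _ _ _ (Proj.affineOpenCover (gr A' N')).openCover ?_
  rintro ⟨⟨d, hd⟩, ⟨a, ha⟩⟩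
  change a ∈ gr A' N' d at ha
  have ha' : grMap g a ∈ gr A N d := symMap_mem g ha
  have h1 : IsPullback (Spec.map (CommRingCat.ofHom (HomogeneousLocalization.Away.map (grMap g) a)))
      (Proj.awayι (gr A N) (grMap g a) ha' hd) (Proj.awayι (gr A' N') a ha hd)
      (Proj.map (grMap g) (irrelevant_le g hg)) :=
    IsOpenImmersion.isPullback _ _ _ _ (Proj.awayι_comp_map _ _ hd a ha) (by
      rw [Proj.opensRange_awayι, Proj.opensRange_awayι, Proj.map_preimage_basicOpen])
  have h2 : IsPullback (Spec.map (CommRingCat.ofHom (HomogeneousLocalization.Away.map (grMap g) a)))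
      (Spec.map (CommRingCat.ofHom (toAway A N (grMap g a))))
      (Spec.map (CommRingCat.ofHom (toAway A' N' a)))
      (Spec.map (CommRingCat.ofHom σ)) := by
    let := σ.toAlgebra
    let := (HomogeneousLocalization.Away.map (grMap g) a).toAlgebra
    have : IsLocalization ((Submonoid.powers f).map (toAway A' N' a))
        (HomogeneousLocalization.Away (gr A N) (grMap g a)) := by
      rw [Submonoid.map_powers]
      exact isLocalization_away σ f g b' b hf hb a ha
    have : IsLocalization (Submonoid.powers f) A := hf
    refine ((CommRingCat.isPushout_of_isLocalization (toAway A' N' a) (toAway A N (grMap g a)) ?_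
      (Submonoid.powers f)).op.map Scheme.Spec).flip
    exact RingHom.ext fun c ↦ (map_toAway σ g a c).symm
  let e := h1.flip.isoPullback
  refine .of_iso h2 e (.refl _) (.refl _) (.refl _) ?_ ?_ ?_ ?_
  · refine (Category.comp_id _).trans ?_
    exact h1.flip.isoPullback_hom_snd.symm
  · refine (Category.comp_id _).trans ?_
    change _ = e.hom ≫ pullback.fst _ _ ≫ _
    rw [← awayι_projToSpec hd _ ha', ← h1.flip.isoPullback_hom_fst, Category.assoc]
  · refine (Category.comp_id _).trans ?_
    exact (awayι_projToSpec hd _ ha).symm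
  · simp

end Localization

variable (A N)

theorem smul_eq_toAway (a : SymmetricAlgebra A N) (c : A)
    (x : HomogeneousLocalization.Away (gr A N) a) : c • x = toAway A N a c * x := by
  apply HomogeneousLocalization.val_injective
  rw [HomogeneousLocalization.val_smul, HomogeneousLocalization.val_mul, val_toAway,
    Algebra.smul_def]
  rfl

noncomputable instance away_algebra (a : SymmetricAlgebra A N) :
    Algebra A (HomogeneousLocalization.Away (gr A N) a) where
  algebraMap := toAway A N a
  commutes' _ _ := mul_comm _ _
  smul_def' c x := smul_eq_toAway A N a c x

/-- The coordinate ring of the affine chart of `Proj (Sym N)` on which `l` does not vanish. -/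
abbrev ChartRing (l : N) : Type u :=
  HomogeneousLocalization.Away (gr A N) (SymmetricAlgebra.ι A N l)

variable {N}

/-- The quotient `m / l`, as a function on the chart on which `l` does not vanish. -/
noncomputable def quot (l m : N) : ChartRing A N l :=
  HomogeneousLocalization.Away.mk (gr A N) (iota_mem A N l) 1 (SymmetricAlgebra.ι A N m)
    (iota_mem A N m)

/-- The generator `e` of the tautological line subbundle of the pullback of the dual of `N` on the
chart on which `l` does not vanish, normalized by `e(l) = 1`: it is the linear form `m ↦ m / l`,
written in terms of a basis of `N`. -/
noncomputable def taut {n : ℕ} (b : Module.Basis (Fin n) A N) (l : N) :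
    ChartRing A N l ⊗[A] Module.Dual A N :=
  ∑ j, quot A l (b j) ⊗ₜ[A] b.coord j

/-- For `m : N` all of whose coordinates lie in the ideal `I`, the composition of
`N^∨ → I`, `t ↦ t m`, with `I → I / I ^ 2 → (A ⧸ I) ⊗ Ω[A⁄k]`, `f ↦ 1 ⊗ df`. -/
noncomputable def dualToKaehler (k : Type u) [CommRing k] [Algebra k A] (I : Ideal A) (m : N)
    (hm : ∀ t : Module.Dual A N, t m ∈ I) :
    Module.Dual A N →ₗ[A] (A ⧸ I) ⊗[A] Ω[A⁄k] where
  toFun t := 1 ⊗ₜ[A] KaehlerDifferential.D k A (t m)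
  map_add' t t' := by rw [LinearMap.add_apply, map_add, TensorProduct.tmul_add]
  map_smul' a t := by
    have h : (1 : A ⧸ I) ⊗ₜ[A] (t m • KaehlerDifferential.D k A a) = 0 := by
      rw [← TensorProduct.smul_tmul, Algebra.smul_def, Ideal.Quotient.algebraMap_eq,
        Ideal.Quotient.eq_zero_iff_mem.mpr (hm t), zero_mul, TensorProduct.zero_tmul]
    rw [LinearMap.smul_apply, smul_eq_mul, Derivation.leibniz, TensorProduct.tmul_add, h, add_zero,
      TensorProduct.tmul_smul, RingHom.id_apply]

end Algebra

noncomputable section Bundle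

variable {V : Scheme.{u}}

/-- Restriction of sections of an `𝒪_V`-module, as a semilinear map. -/
def res (M : V.Modules) {U W : V.Opens} (h : W ≤ U) :
    Γ(M, U) →ₛₗ[(V.presheaf.map (homOfLE h).op).hom] Γ(M, W) where
  toFun := M.presheaf.map (homOfLE h).op
  map_add' := map_add _
  map_smul' a x := Scheme.Modules.map_smul M (homOfLE h) a x

theorem res_res (M : V.Modules) {U W T : V.Opens} (h : W ≤ U) (h' : T ≤ W) (x : Γ(M, U)) :
    res M h' (res M h x) = res M (h'.trans h) x := by
  change M.presheaf.map _ (M.presheaf.map _ x) = M.presheaf.map _ x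
  rw [← ConcreteCategory.comp_apply, ← Functor.map_comp]
  rfl

theorem res_self (M : V.Modules) {U : V.Opens} (x : Γ(M, U)) : res M (le_refl U) x = x := by
  change M.presheaf.map (𝟙 _) x = x
  rw [CategoryTheory.Functor.map_id]
  rfl

/-- `b` is a frame of `M` over `U`: its restriction to every open subset `W` of `U` is a basis of
`Γ(M, W)` over `Γ(V, W)`, so that `b` is an isomorphism `𝒪_U ^ n ≅ M|_U`. -/
def IsFrame (M : V.Modules) (U : V.Opens) {n : ℕ} (b : Fin n → Γ(M, U)) : Prop :=
  ∀ (W : V.Opens) (h : W ≤ U), LinearIndependent Γ(V, W) (fun j ↦ res M h (b j)) ∧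
    Submodule.span Γ(V, W) (Set.range fun j ↦ res M h (b j)) = ⊤

theorem IsFrame.res {M : V.Modules} {U W : V.Opens} {n : ℕ} {b : Fin n → Γ(M, U)}
    (hb : IsFrame M U b) (h : W ≤ U) : IsFrame M W fun j ↦ res M h (b j) := by
  intro T h'
  simp only [res_res]
  exact hb T (h'.trans h)

/-- The basis given by a frame. -/
def IsFrame.basis {M : V.Modules} {U : V.Opens} {n : ℕ} {b : Fin n → Γ(M, U)}
    (hb : IsFrame M U b) {W : V.Opens} (h : W ≤ U) : Module.Basis (Fin n) Γ(V, W) Γ(M, W) :=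
  .mk (hb W h).1 (hb W h).2.ge

theorem IsFrame.basis_apply {M : V.Modules} {U : V.Opens} {n : ℕ} {b : Fin n → Γ(M, U)}
    (hb : IsFrame M U b) {W : V.Opens} (h : W ≤ U) (j) :
    hb.basis h j = ProjBundle.res M h (b j) := by
  simp [IsFrame.basis]

variable (V) in
/-- A vector bundle of rank `n` on `V`, given by its sheaf of sections: an `𝒪_V`-module which is
locally free of rank `n`. -/
structure VectorBundle (n : ℕ) where
  /-- The sheaf of sections. -/
  sheaf : V.Modules
  locally_free (x : V) : ∃ U : V.Opens, x ∈ U ∧ ∃ b : Fin n → Γ(sheaf, U), IsFrame sheaf U b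

namespace VectorBundle

variable {n : ℕ} (E : VectorBundle V n)

/-- The affine open subsets of `V` over which `E` is trivial, ordered by `D(f) ≤ U` for
`f ∈ Γ(V, U)`. -/
def Patch : Type u :=
  {U : V.AffineZariskiSite // ∃ b : Fin n → Γ(E.sheaf, U.toOpens), IsFrame E.sheaf U.toOpens b}

instance : Preorder E.Patch :=
  inferInstanceAs (Preorder {U : V.AffineZariskiSite // _})

variable {E} in
/-- The underlying open subset. -/
abbrev Patch.opens (U : E.Patch) : V.Opens := U.1.toOpens

variable {E} in
theorem Patch.le {U W : E.Patch} (h : W ≤ U) : W.opens ≤ U.opens :=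
  Scheme.AffineZariskiSite.toOpens_mono (show W.1 ≤ U.1 from h)

variable {E} in
/-- The smaller patch `D(f)`. -/
def Patch.basicOpen (U : E.Patch) (f : Γ(V, U.opens)) : E.Patch :=
  ⟨U.1.basicOpen f, U.2.elim fun _ hb ↦ ⟨_, hb.res (V.basicOpen_le f)⟩⟩

variable {E} in
theorem Patch.basicOpen_le (U : E.Patch) (f : Γ(V, U.opens)) : U.basicOpen f ≤ U :=
  U.1.basicOpen_le f

theorem exists_patch (x : V) : ∃ U : E.Patch, x ∈ U.opens := by
  obtain ⟨U, hx, b, hb⟩ := E.locally_free x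
  obtain ⟨_, ⟨W, hW, rfl⟩, hxW, hWU⟩ := V.isBasis_affineOpens.exists_subset_of_mem_open hx U.2
  exact ⟨⟨⟨W, hW⟩, _, hb.res hWU⟩, hxW⟩

/-- The cover of `V` by the affine open subsets over which `E` is trivial. -/
abbrev cover : V.OpenCover where
  I₀ := E.Patch
  X U := U.opens
  f U := U.opens.ι
  mem₀ := by
    rw [Scheme.presieve₀_mem_precoverage_iff]
    refine ⟨fun x ↦ ?_, inferInstance⟩
    obtain ⟨U, hxU⟩ := E.exists_patch x
    exact ⟨U, ⟨x, hxU⟩, rfl⟩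

instance : E.cover.LocallyDirected where
  trans f := V.homOfLE (Patch.le f.le)
  trans_id _ := Scheme.homOfLE_rfl _ _
  trans_comp _ _ := (Scheme.homOfLE_homOfLE _ _ _).symm
  w _ := Scheme.homOfLE_ι _ _
  directed {U W} x := by
    let a := (pullback.fst _ _ ≫ U.opens.ι) x
    have haU : a ∈ U.opens := (pullback.fst U.opens.ι W.opens.ι x).2
    have haV : a ∈ W.opens := by
      unfold a; rw [pullback.condition]; exact (pullback.snd U.opens.ι W.opens.ι x).2
    obtain ⟨f, g, e, hxf⟩ := exists_basicOpen_le_affine_inter U.1.2 W.1.2 _ ⟨haU, haV⟩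
    refine ⟨U.basicOpen f, homOfLE (U.basicOpen_le f), homOfLE ⟨g, e.symm⟩, ⟨a, hxf⟩, ?_⟩
    apply (pullback.fst _ _ ≫ U.opens.ι).isOpenEmbedding.injective
    change (pullback.lift _ _ _ ≫ pullback.fst _ _ ≫ U.opens.ι) _ = _
    simp only [pullback.lift_fst_assoc, Scheme.homOfLE_ι, Scheme.Opens.ι_apply]
    rfl

variable {E} in
theorem Patch.span_res {U W : E.Patch} (h : W ≤ U) :
    Submodule.span Γ(V, W.opens) (Set.range (res E.sheaf (Patch.le h))) = ⊤ := by
  obtain ⟨b, hb⟩ := U.2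
  exact span_range_eq_top _ _ (hb.basis le_rfl) (hb.basis (Patch.le h)) fun i ↦ by
    rw [hb.basis_apply, hb.basis_apply, res_res]

variable {E} in
theorem Patch.grMap_self (U : E.Patch) :
    grMap (res E.sheaf (le_refl U.opens)) =
      GradedRingHom.id (gr Γ(V, U.opens) Γ(E.sheaf, U.opens)) := by
  refine GradedRingHom.ext fun x ↦ ?_
  suffices h : symMap (res E.sheaf (le_refl U.opens)) = RingHom.id _ from congr($h x)
  refine ringHom_ext (fun a ↦ ?_) fun m ↦ ?_
  · rw [symMap_algebraMap]
    change algebraMap _ _ (V.presheaf.map (𝟙 _) a) = _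
    rw [CategoryTheory.Functor.map_id]
    rfl
  · rw [symMap_iota, res_self]
    rfl

variable {E} in
theorem Patch.grMap_comp {U W T : E.Patch} (h : W ≤ U) (h' : T ≤ W) :
    grMap (res E.sheaf (Patch.le (h'.trans h))) =
      (grMap (res E.sheaf (Patch.le h'))).comp (grMap (res E.sheaf (Patch.le h))) := by
  refine GradedRingHom.ext fun x ↦ ?_
  suffices h : symMap (res E.sheaf (Patch.le (h'.trans h))) =
      (symMap (res E.sheaf (Patch.le h'))).comp (symMap (res E.sheaf (Patch.le h))) from
    congr($h x)
  refine ringHom_ext (fun a ↦ ?_) fun m ↦ ?_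
  · rw [symMap_algebraMap, RingHom.comp_apply, symMap_algebraMap, symMap_algebraMap]
    congr 1
    change _ = V.presheaf.map _ (V.presheaf.map _ a)
    rw [← ConcreteCategory.comp_apply, ← Functor.map_comp]
    rfl
  · rw [symMap_iota, RingHom.comp_apply, symMap_iota, symMap_iota, res_res]

/-- `U ↦ Proj (Sym Γ(E, U))`. -/
def projFunctor : E.Patch ⥤ Scheme.{u} where
  obj U := Proj (gr Γ(V, U.opens) Γ(E.sheaf, U.opens))
  map h := Proj.map (grMap (res E.sheaf (Patch.le h.le))) (irrelevant_le _ (Patch.span_res h.le))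
  map_id U := by
    rw [← Proj.map_id]
    congr 1
    exact Patch.grMap_self U
  map_comp h h' := by
    rw [← Proj.map_comp]
    congr 1
    exact Patch.grMap_comp h'.le h.le

variable {E} in
theorem Patch.isPullback {U W : E.Patch} (h : W ≤ U) :
    IsPullback (E.projFunctor.map (homOfLE h))
      (projToSpec Γ(V, W.opens) Γ(E.sheaf, W.opens)) (projToSpec Γ(V, U.opens) Γ(E.sheaf, U.opens))
      (Spec.map (V.presheaf.map (homOfLE (Patch.le h)).op)) := by
  obtain ⟨b, hb⟩ := U.2
  obtain ⟨f, hf⟩ := id h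
  obtain rfl : U.basicOpen f = W := Subtype.ext (Subtype.ext hf)
  refine isPullback_projMap (V.presheaf.map (homOfLE (V.basicOpen_le f)).op).hom f
    (res E.sheaf (V.basicOpen_le f)) (hb.basis le_rfl) (hb.basis (V.basicOpen_le f))
    (U.1.2.isLocalization_basicOpen f) (fun i ↦ ?_) (Patch.span_res h)
  rw [hb.basis_apply, hb.basis_apply, res_res]

variable {E} in
theorem Patch.isPullback_isoSpec {U W : E.Patch} (h : W ≤ U) :
    IsPullback (Spec.map (V.presheaf.map (homOfLE (Patch.le h)).op)) W.1.2.isoSpec.inv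
      U.1.2.isoSpec.inv (V.homOfLE (Patch.le h)) :=
  .of_vert_isIso ⟨((Scheme.AffineZariskiSite.restrictIsoSpec V).inv.naturality
    (homOfLE (show W.1 ≤ U.1 from h)))⟩

/-- The schemes `Proj (Sym Γ(E, U))` over the affine open subsets `U` trivializing `E`, as gluing
data over `V`. -/
def gluingData : E.cover.RelativeGluingData where
  functor := E.projFunctor
  natTrans :=
    { app U := projToSpec Γ(V, U.opens) Γ(E.sheaf, U.opens) ≫ U.1.2.isoSpec.inv
      naturality _ _ h := ((Patch.isPullback h.le).paste_vert (Patch.isPullback_isoSpec h.le)).w }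
  equifibered _ _ h := (Patch.isPullback h.le).paste_vert (Patch.isPullback_isoSpec h.le)

/-- The projective bundle `Proj (Sym 𝓔)` where `𝓔` is the sheaf of sections of `E`. Its points
are the lines in the fibers of the dual bundle of `E`. -/
def proj : Scheme.{u} := E.gluingData.glued

/-- The projection to `V`. -/
def π : E.proj ⟶ V := E.gluingData.toBase

/-- The affine chart of the projective bundle over `U` on which the section `l` of `E`, a linear
form on the fibers of the dual bundle, does not vanish. -/
def chart (U : E.Patch) (l : Γ(E.sheaf, U.opens)) :
    Spec (.of (ChartRing Γ(V, U.opens) Γ(E.sheaf, U.opens) l)) ⟶ E.proj :=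
  Proj.awayι (gr Γ(V, U.opens) Γ(E.sheaf, U.opens)) _ (iota_mem _ _ l) one_pos ≫
    E.gluingData.cover.f U

end VectorBundle

/-- The ideal of `R` cutting out the pullback to `Spec R` of a closed subscheme. -/
def onSpec {Y : Scheme.{u}} (J : Y.IdealSheafData) {R : CommRingCat.{u}} (f : Spec R ⟶ Y) :
    Ideal R :=
  ((J.comap f).ideal ⟨⊤, isAffineOpen_top _⟩).comap (Scheme.ΓSpecIso R).inv.hom

/-- The `k`-algebra of functions on an open subset of a scheme over `k`. -/
abbrev sectionsAlgebra {k : Type u} [CommRing k] {Y : Scheme.{u}} (p : Y ⟶ Spec (.of k))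
    (W : Y.Opens) : Algebra k Γ(Y, W) :=
  ((Scheme.ΓSpecIso (.of k)).inv ≫ p.appLE ⊤ W le_top).hom.toAlgebra

/-- The ideal sheaf of the singularity subscheme of the closed subscheme `Z` of `Y` with ideal sheaf
`I`, for `Y` over `k`: the largest closed subscheme of `Z` on which the morphism
`I / I ^ 2 → Ω_Y|_Z`, `f ↦ df`, vanishes. -/
def singularityIdeal {k : Type u} [CommRing k] {Y : Scheme.{u}} (p : Y ⟶ Spec (.of k))
    (I : Y.IdealSheafData) : Y.IdealSheafData :=
  sInf {J | I ≤ J ∧ ∀ W : Y.affineOpens, ∀ f ∈ I.ideal W,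
    letI := sectionsAlgebra p W
    KaehlerDifferential.D k Γ(Y, W) f ∈ J.ideal W • (⊤ : Submodule Γ(Y, W) Ω[Γ(Y, W)⁄k])}

namespace VectorBundle

variable {n : ℕ} (E : VectorBundle V n) (s : Γ(E.sheaf, ⊤))

variable {E} in
/-- The restriction to `U` of a global section of `E`. -/
abbrev Patch.sec (U : E.Patch) (s : Γ(E.sheaf, ⊤)) : Γ(E.sheaf, U.opens) :=
  res E.sheaf le_top s

/-- `X` is the ideal sheaf of the zero scheme of the section `s` of `E`: it is the image of the
morphism from the sheaf of sections of the dual bundle to `𝒪_V` given by evaluation at `s`. -/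
def IsZeroScheme (X : V.IdealSheafData) : Prop :=
  ∀ U : E.Patch, X.ideal ⟨U.opens, U.1.2⟩ =
    LinearMap.range (Module.Dual.eval Γ(V, U.opens) Γ(E.sheaf, U.opens) (U.sec s))

/-- The ideal sheaf of the zero scheme of the section `ε ∘ π^* s` of `𝒪(1)` on the projective bundle,
where `ε` is the canonical morphism from `π^* E` to `𝒪(1)`: the largest closed subscheme on which
this section vanishes. On the chart on which `l` does not vanish, `𝒪(1)` is trivialized by `ε(l)`,
and `ε(m) = (m / l) ε(l)`. -/
def hypersurfaceIdeal : E.proj.IdealSheafData :=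
  sInf {J | ∀ (U : E.Patch) (l : Γ(E.sheaf, U.opens)),
    quot Γ(V, U.opens) l (U.sec s) ∈ onSpec J (E.chart U l)}

variable {E s} in
theorem IsZeroScheme.dual_mem {X : V.IdealSheafData} (hX : E.IsZeroScheme s X) (U : E.Patch)
    (t : Module.Dual Γ(V, U.opens) Γ(E.sheaf, U.opens)) :
    t (U.sec s) ∈ X.ideal ⟨U.opens, U.1.2⟩ := by
  rw [hX U]
  exact ⟨t, rfl⟩

/-- The ideal sheaf in the projective bundle of the zero scheme of the composition
`𝒪(-1) → ρ^* E^∨|_X → ρ^* T^*V|_X` over the part of the projective bundle over `X`, where `X` is the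
zero scheme of `s` and `E^∨|_X → T^*V|_X` is the composition of evaluation at `s` with
`I_X / I_X ^ 2 → Ω_V|_X`: the largest closed subscheme, contained in the inverse image of `X`,
on which this composition vanishes. -/
def tyurinaIdeal {k : Type u} [CommRing k] (p : V ⟶ Spec (.of k)) {X : V.IdealSheafData}
    (hX : E.IsZeroScheme s X) : E.proj.IdealSheafData :=
  sInf {J | X.comap E.π ≤ J ∧ ∀ (U : E.Patch) (l : Γ(E.sheaf, U.opens))
    (b : Module.Basis (Fin n) Γ(V, U.opens) Γ(E.sheaf, U.opens)),
    letI := sectionsAlgebra p U.opens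
    (dualToKaehler Γ(V, U.opens) k (X.ideal ⟨U.opens, U.1.2⟩) (U.sec s) (hX.dual_mem U)).baseChange
        (ChartRing Γ(V, U.opens) Γ(E.sheaf, U.opens) l) (taut Γ(V, U.opens) b l) ∈
      onSpec J (E.chart U l) • (⊤ : Submodule (ChartRing Γ(V, U.opens) Γ(E.sheaf, U.opens) l)
        (ChartRing Γ(V, U.opens) Γ(E.sheaf, U.opens) l ⊗[Γ(V, U.opens)]
          ((Γ(V, U.opens) ⧸ X.ideal ⟨U.opens, U.1.2⟩) ⊗[Γ(V, U.opens)] Ω[Γ(V, U.opens)⁄k])))}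

end VectorBundle

end Bundle

end ProjBundle

/-!
On the chart on which `l` does not vanish, the function `m / l` of a section `m` of `E` is linear in
`m` and equal to `1` at `l`, and it is universal with these properties. Mapping to square-zero
extensions, a derivation of the base and a compatible additive map on `E` therefore induce a
derivation of the chart. On this chart `𝒳` is the zero scheme of `s / l`, and for a basis `b` of
`E`, `d(s / l) = ∑ b_j^*(s) d(b_j / l) + ∑ (b_j / l) d(b_j^*(s))`. On a closed subscheme over `X`
the first sum vanishes, and the second one is the image of the generator `∑ (b_j / l) b_j^*` of
`𝒪(-1)` under `𝒪(-1) → T^*V|_X`. Hence `𝒳` is singular along `𝒴`.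

Conversely, let `𝒳` be singular along a closed subscheme `J`, so that every derivation kills `s / l`
along `J`. For a section `t` of `E^∨`, the vertical derivation `m / l ↦ t(m) - (m / l) t(l)` shows
that `t(s)` vanishes along `J`, so that `J` lies over `X`. The derivation extending the universal
derivation of the base with respect to `b` then shows that the generator of `𝒪(-1)` is killed
along `J`.
-/

namespace ProjBundle

section StalkIdeals

variable {Y : Scheme.{u}}

/-- Restriction of functions to a smaller open subset, as a ring homomorphism. -/
abbrev resHom {U W : Y.Opens} (h : W ≤ U) : Γ(Y, U) →+* Γ(Y, W) :=
  (Y.presheaf.map (homOfLE h).op).hom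

/-- The germ at a point, as a ring homomorphism. -/
noncomputable abbrev germHom {U : Y.Opens} {x : Y} (hx : x ∈ U) : Γ(Y, U) →+* Y.presheaf.stalk x :=
  (Y.presheaf.germ U x hx).hom

theorem resHom_resHom {U W T : Y.Opens} (h : W ≤ U) (h' : T ≤ W) (x : Γ(Y, U)) :
    resHom h' (resHom h x) = resHom (h'.trans h) x := by
  rw [resHom, resHom, ← ConcreteCategory.comp_apply, ← Functor.map_comp]
  rfl

theorem germHom_comp_resHom {U W : Y.Opens} (h : W ≤ U) {x : Y} (hx : x ∈ W) :
    (germHom hx).comp (resHom h) = germHom (h hx) := by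
  rw [← CommRingCat.hom_comp, Y.presheaf.germ_res]

theorem germHom_resHom {U W : Y.Opens} (h : W ≤ U) {x : Y} (hx : x ∈ W) (f : Γ(Y, U)) :
    germHom hx (resHom h f) = germHom (h hx) f :=
  Y.presheaf.germ_res_apply (homOfLE h) x hx f

variable (K : ∀ x : Y, Ideal (Y.presheaf.stalk x))

/-- The ideal of the functions on `W` whose germs lie in a given family of ideals of the stalks. -/
noncomputable def stalkwiseIdeal (W : Y.Opens) : Ideal Γ(Y, W) :=
  ⨅ x : W, (K x).comap (germHom x.2)

/-- The ideal `I` of functions on `U` generates the ideal `K x` of the stalk at every point `x`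
of `U`. -/
def GeneratesStalks {U : Y.Opens} (I : Ideal Γ(Y, U)) : Prop :=
  ∀ x (hx : x ∈ U), I.map (germHom hx) = K x

/-- The ideals `K x` of the stalks are the stalks of a quasi-coherent sheaf of ideals: near every
point they are generated by an ideal of functions on an open neighbourhood. -/
def IsLocallyGenerated : Prop :=
  ∀ x : Y, ∃ (U : Y.Opens) (I : Ideal Γ(Y, U)), x ∈ U ∧ GeneratesStalks K I

variable {K}

theorem mem_stalkwiseIdeal {W : Y.Opens} {f : Γ(Y, W)} :
    f ∈ stalkwiseIdeal K W ↔ ∀ x (hx : x ∈ W), germHom hx f ∈ K x := by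
  simp [stalkwiseIdeal]

theorem resHom_mem_stalkwiseIdeal {W T : Y.Opens} (h : T ≤ W) {f : Γ(Y, W)}
    (hf : f ∈ stalkwiseIdeal K W) : resHom h f ∈ stalkwiseIdeal K T :=
  mem_stalkwiseIdeal.mpr fun x hx ↦ by
    rw [germHom_resHom]
    exact mem_stalkwiseIdeal.mp hf x (h hx)

namespace GeneratesStalks

variable {U : Y.Opens} {I : Ideal Γ(Y, U)}

theorem map_resHom (hI : GeneratesStalks K I) {W : Y.Opens} (h : W ≤ U) :
    GeneratesStalks K (I.map (resHom h)) := fun x hx ↦ by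
  rw [Ideal.map_map, germHom_comp_resHom, hI x (h hx)]

theorem stalkwiseIdeal_eq (hI : GeneratesStalks K I) (hU : IsAffineOpen U) :
    stalkwiseIdeal K U = I := by
  ext f
  simp only [mem_stalkwiseIdeal, hU.mem_ideal_iff (I := I)]
  exact forall₂_congr fun x hx ↦ by rw [hI x hx]

theorem exists_pow_mul_mem (hI : GeneratesStalks K I) (hU : IsAffineOpen U) {g h : Γ(Y, U)}
    (hh : resHom (Y.basicOpen_le g) h ∈ stalkwiseIdeal K (Y.basicOpen g)) :
    ∃ n, g ^ n * h ∈ stalkwiseIdeal K U := by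
  have := hU.isLocalization_basicOpen g
  rw [(hI.map_resHom (Y.basicOpen_le g)).stalkwiseIdeal_eq (hU.basicOpen g)] at hh
  obtain ⟨_, ⟨n, rfl⟩, hn⟩ :=
    (IsLocalization.algebraMap_mem_map_algebraMap_iff (.powers g) _ _ _).mp hh
  exact ⟨n, by rwa [hI.stalkwiseIdeal_eq hU]⟩

end GeneratesStalks

namespace IsLocallyGenerated

variable (hK : IsLocallyGenerated K) {W : Y.Opens} (hW : IsAffineOpen W)
include hK hW

theorem exists_basicOpen {x : Y} (hx : x ∈ W) :
    ∃ (e : Γ(Y, W)) (I : Ideal Γ(Y, Y.basicOpen e)), x ∈ Y.basicOpen e ∧ GeneratesStalks K I := by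
  obtain ⟨U, I, hxU, hI⟩ := hK x
  obtain ⟨e, he, hxe⟩ := hW.exists_basicOpen_le ⟨x, hxU⟩ hx
  exact ⟨e, _, hxe, hI.map_resHom he⟩

theorem exists_pow_mul_mem_near {g h : Γ(Y, W)}
    (hh : resHom (Y.basicOpen_le g) h ∈ stalkwiseIdeal K (Y.basicOpen g)) {x : Y} (hx : x ∈ W) :
    ∃ T : Y.Opens, x ∈ T ∧ ∃ n, ∀ y ∈ T, ∀ hy : y ∈ W, germHom hy (g ^ n * h) ∈ K y := by
  obtain ⟨e, I, hxe, hI⟩ := hK.exists_basicOpen hW hx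
  have he := Y.basicOpen_le e
  have hge : Y.basicOpen (resHom he g) ≤ Y.basicOpen g := by
    rw [Scheme.basicOpen_res]
    exact inf_le_right
  have hres : resHom (Y.basicOpen_le (resHom he g)) (resHom he h) ∈ stalkwiseIdeal K _ := by
    rw [resHom_resHom, ← resHom_resHom (Y.basicOpen_le g) hge]
    exact resHom_mem_stalkwiseIdeal hge hh
  obtain ⟨n, hn⟩ := hI.exists_pow_mul_mem (hW.basicOpen e) hres
  refine ⟨Y.basicOpen e, hxe, n, fun y hy _ ↦ ?_⟩
  rw [← germHom_resHom he hy, map_mul, map_pow]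
  exact mem_stalkwiseIdeal.mp hn y hy

theorem exists_pow_mul_mem {g h : Γ(Y, W)}
    (hh : resHom (Y.basicOpen_le g) h ∈ stalkwiseIdeal K (Y.basicOpen g)) :
    ∃ n, g ^ n * h ∈ stalkwiseIdeal K W := by
  have mem_of_le {x} (hx : x ∈ W) {m n : ℕ} (hmn : m ≤ n) (hm : germHom hx (g ^ m * h) ∈ K x) :
      germHom hx (g ^ n * h) ∈ K x := by
    rw [← Nat.sub_add_cancel hmn, pow_add, mul_assoc, map_mul]
    exact Ideal.mul_mem_left _ _ hm
  suffices H : ∃ n, ∀ x ∈ (W : Set Y), ∀ hx : x ∈ W, germHom hx (g ^ n * h) ∈ K x from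
    H.imp fun n hn ↦ mem_stalkwiseIdeal.mpr fun x hx ↦ hn x hx hx
  refine hW.isCompact.induction_on
    (p := fun S ↦ ∃ n, ∀ x ∈ S, ∀ hx : x ∈ W, germHom hx (g ^ n * h) ∈ K x)
    ⟨0, fun x hx ↦ hx.elim⟩ (fun S T hST ⟨n, hn⟩ ↦ ⟨n, fun x hx ↦ hn x (hST hx)⟩) ?_ ?_
  · rintro S T ⟨n, hn⟩ ⟨m, hm⟩
    exact ⟨max n m, fun x hx hxW ↦ hx.elim
      (fun hxS ↦ mem_of_le hxW (le_max_left n m) (hn x hxS hxW))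
      (fun hxT ↦ mem_of_le hxW (le_max_right n m) (hm x hxT hxW))⟩
  · intro x hx
    obtain ⟨T, hxT, hT⟩ := hK.exists_pow_mul_mem_near hW hh hx
    exact ⟨T, mem_nhdsWithin_of_mem_nhds (T.2.mem_nhds hxT), hT⟩

theorem map_stalkwiseIdeal_basicOpen (g : Γ(Y, W)) :
    (stalkwiseIdeal K W).map (resHom (Y.basicOpen_le g)) = stalkwiseIdeal K (Y.basicOpen g) := by
  have := hW.isLocalization_basicOpen g
  refine le_antisymm (Ideal.map_le_iff_le_comap.mpr fun f ↦ resHom_mem_stalkwiseIdeal _)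
    fun f hf ↦ ?_
  obtain ⟨h, ⟨_, k, rfl⟩, rfl⟩ := IsLocalization.exists_mk'_eq (.powers g) f
  refine (IsLocalization.mk'_mem_map_algebraMap_iff _ _ _ _ _).mpr ?_
  have hh : resHom (Y.basicOpen_le g) h ∈ stalkwiseIdeal K (Y.basicOpen g) := by
    rw [← show algebraMap _ _ (g ^ k) * _ = resHom (Y.basicOpen_le g) h from
      IsLocalization.mk'_spec' _ h (⟨_, k, rfl⟩ : Submonoid.powers g)]
    exact Ideal.mul_mem_left _ _ hf
  obtain ⟨n, hn⟩ := hK.exists_pow_mul_mem hW hh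
  exact ⟨_, ⟨n, rfl⟩, hn⟩

omit hW in
theorem exists_idealSheafData :
    ∃ J : Y.IdealSheafData, ∀ W : Y.affineOpens, J.ideal W = stalkwiseIdeal K W :=
  ⟨⟨fun W ↦ stalkwiseIdeal K W, fun W ↦ hK.map_stalkwiseIdeal_basicOpen W.2, _, rfl⟩,
    fun _ ↦ rfl⟩

end IsLocallyGenerated

theorem exists_idealSheafData_ideal_eq {ι : Type*} {U : ι → Y.Opens}
    (hU : ∀ i, IsAffineOpen (U i)) (hcov : ⨆ i, U i = ⊤) (I : ∀ i, Ideal Γ(Y, U i))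
    (hI : ∀ i j x (hi : x ∈ U i) (hj : x ∈ U j),
      (I i).map (germHom hi) ≤ (I j).map (germHom hj)) :
    ∃ J : Y.IdealSheafData, ∀ i, J.ideal ⟨U i, hU i⟩ = I i := by
  choose c hc using fun x : Y ↦ TopologicalSpace.Opens.mem_iSup.mp (hcov.ge (Set.mem_univ x))
  have hI' i : GeneratesStalks (fun x ↦ (I (c x)).map (germHom (hc x))) (I i) :=
    fun x hx ↦ le_antisymm (hI ..) (hI ..)
  obtain ⟨J, hJ⟩ := IsLocallyGenerated.exists_idealSheafData fun x ↦ ⟨_, _, hc x, hI' (c x)⟩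
  exact ⟨J, fun i ↦ (hJ _).trans ((hI' i).stalkwiseIdeal_eq (hU i))⟩

end StalkIdeals

section Charts

variable {Y Z : Scheme.{u}}

/-- Closed subschemes of the affine scheme `Spec R` correspond to ideals of `R`. -/
noncomputable def specIdeal (R : CommRingCat.{u}) : (Spec R).IdealSheafData ≃o Ideal R :=
  Scheme.IdealSheafData.equivOfIsAffine.toOrderIso.trans
    (Scheme.ΓSpecIso R).commRingCatIsoToRingEquiv.symm.idealComapOrderIso

theorem onSpec_eq_specIdeal {R : CommRingCat.{u}} (X : Y.IdealSheafData) (c : Spec R ⟶ Y) :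
    onSpec X c = specIdeal R (X.comap c) :=
  rfl

theorem specIdeal_map {R S : CommRingCat.{u}} (φ : R ⟶ S) (J : (Spec S).IdealSheafData) :
    specIdeal R (J.map (Spec.map φ)) = (specIdeal S J).comap φ.hom := by
  change ((J.map (Spec.map φ)).ideal ⟨⊤, isAffineOpen_top _⟩).comap (Scheme.ΓSpecIso R).inv.hom =
    ((J.ideal ⟨⊤, isAffineOpen_top _⟩).comap (Scheme.ΓSpecIso S).inv.hom).comap φ.hom
  have hmap : (J.map (Spec.map φ)).ideal ⟨⊤, isAffineOpen_top _⟩ =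
      (J.ideal ⟨⊤, isAffineOpen_top _⟩).comap (Spec.map φ).appTop.hom :=
    Scheme.IdealSheafData.ideal_map_of_isAffineHom _ _ _
  rw [hmap, Ideal.comap_comap, Ideal.comap_comap, ← CommRingCat.hom_comp, ← CommRingCat.hom_comp,
    Scheme.ΓSpecIso_inv_naturality]

theorem specIdeal_comap {R S : CommRingCat.{u}} (φ : R ⟶ S) (I : (Spec R).IdealSheafData) :
    specIdeal S (I.comap (Spec.map φ)) = (specIdeal R I).map φ.hom := by
  refine eq_of_forall_ge_iff fun K ↦ ?_
  obtain ⟨J, rfl⟩ := (specIdeal S).surjective K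
  rw [OrderIso.le_iff_le, ← Scheme.IdealSheafData.le_map_iff_comap_le, Ideal.map_le_iff_le_comap,
    ← specIdeal_map, OrderIso.le_iff_le]

theorem onSpec_SpecMap_comp {R S : CommRingCat.{u}} (φ : R ⟶ S) (c : Spec R ⟶ Y)
    (X : Y.IdealSheafData) : onSpec X (Spec.map φ ≫ c) = (onSpec X c).map φ.hom := by
  rw [onSpec_eq_specIdeal, Scheme.IdealSheafData.comap_comp, specIdeal_comap, onSpec_eq_specIdeal]

theorem onSpec_comap {R : CommRingCat.{u}} (q : Z ⟶ Y) (X : Y.IdealSheafData) (c : Spec R ⟶ Z) :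
    onSpec (X.comap q) c = onSpec X (c ≫ q) := by
  rw [onSpec, ← Scheme.IdealSheafData.comap_comp, onSpec]

theorem onSpec_mono {R : CommRingCat.{u}} {I J : Y.IdealSheafData} (h : I ≤ J) (c : Spec R ⟶ Y) :
    onSpec I c ≤ onSpec J c :=
  Ideal.comap_mono (Scheme.IdealSheafData.comap_mono c h _)

/-- The functions on an affine chart, as functions on its image. -/
noncomputable def chartHom {R : CommRingCat.{u}} (c : Spec R ⟶ Y) [IsOpenImmersion c] :
    R →+* Γ(Y, c ''ᵁ ⊤) :=
  ((Scheme.ΓSpecIso R).inv ≫ (c.appIso ⊤).inv).hom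

theorem chartHom_bijective {R : CommRingCat.{u}} (c : Spec R ⟶ Y) [IsOpenImmersion c] :
    Function.Bijective (chartHom c) :=
  ConcreteCategory.bijective_of_isIso ((Scheme.ΓSpecIso R).inv ≫ (c.appIso ⊤).inv)

theorem isAffineOpen_image {R : CommRingCat.{u}} (c : Spec R ⟶ Y) [IsOpenImmersion c] :
    IsAffineOpen (c ''ᵁ ⊤) :=
  (isAffineOpen_top _).image_of_isOpenImmersion c

theorem onSpec_eq_comap_chartHom {R : CommRingCat.{u}} (c : Spec R ⟶ Y) [IsOpenImmersion c]
    (J : Y.IdealSheafData) :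
    onSpec J c = (J.ideal ⟨c ''ᵁ ⊤, isAffineOpen_image c⟩).comap (chartHom c) := by
  rw [onSpec, J.ideal_comap_of_isOpenImmersion c, Ideal.comap_comap]
  rfl

theorem map_chartHom_onSpec {R : CommRingCat.{u}} (c : Spec R ⟶ Y) [IsOpenImmersion c]
    (J : Y.IdealSheafData) :
    (onSpec J c).map (chartHom c) = J.ideal ⟨c ''ᵁ ⊤, isAffineOpen_image c⟩ := by
  rw [onSpec_eq_comap_chartHom, Ideal.map_comap_of_surjective _ (chartHom_bijective c).2]

theorem image_fromSpec_top {U : Y.Opens} (hU : IsAffineOpen U) : hU.fromSpec ''ᵁ ⊤ = U := by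
  rw [Scheme.Hom.image_top_eq_opensRange, hU.opensRange_fromSpec]

theorem chartHom_fromSpec {U : Y.Opens} (hU : IsAffineOpen U) :
    chartHom hU.fromSpec = resHom (image_fromSpec_top hU).le := by
  suffices h : (Scheme.ΓSpecIso Γ(Y, U)).inv ≫ (hU.fromSpec.appIso ⊤).inv =
      Y.presheaf.map (homOfLE (image_fromSpec_top hU).le).op from congr(($h).hom)
  rw [Iso.comp_inv_eq, Scheme.Hom.appIso_hom', Scheme.Hom.map_appLE, Scheme.Hom.appLE,
    hU.fromSpec_app_self, Category.assoc, ← Functor.map_comp]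
  exact (Category.comp_id _).symm.trans congr(_ ≫ $((CategoryTheory.Functor.map_id _ _).symm))

theorem comap_resHom_ideal (X : Y.IdealSheafData) (U W : Y.affineOpens) (h : W.1 = U.1) :
    (X.ideal W).comap (resHom h.le) = X.ideal U := by
  obtain rfl := Subtype.ext h
  rw [resHom, show (homOfLE (le_refl W.1)).op = 𝟙 _ from rfl, CategoryTheory.Functor.map_id]
  exact Ideal.comap_id _

theorem onSpec_fromSpec (X : Y.IdealSheafData) {U : Y.Opens} (hU : IsAffineOpen U) :
    onSpec X hU.fromSpec = X.ideal ⟨U, hU⟩ := by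
  rw [onSpec_eq_comap_chartHom, chartHom_fromSpec]
  exact comap_resHom_ideal X ⟨U, hU⟩ ⟨_, isAffineOpen_image _⟩ (image_fromSpec_top hU)

section Subchart

variable {R S : CommRingCat.{u}} (φ : R ⟶ S) {c : Spec R ⟶ Y} [IsOpenImmersion c]
  {d : Spec S ⟶ Y} [IsOpenImmersion d] (h : d = Spec.map φ ≫ c)
include h

theorem image_top_le_of_factors : d ''ᵁ ⊤ ≤ c ''ᵁ ⊤ := by
  subst h
  rintro _ ⟨x, -, rfl⟩
  exact ⟨Spec.map φ x, trivial, rfl⟩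

theorem resHom_comp_chartHom :
    (resHom (image_top_le_of_factors φ h)).comp (chartHom c) = (chartHom d).comp φ.hom := by
  suffices key : (Scheme.ΓSpecIso R).inv ≫ (c.appIso ⊤).inv ≫
      Y.presheaf.map (homOfLE (image_top_le_of_factors φ h)).op =
      φ ≫ (Scheme.ΓSpecIso S).inv ≫ (d.appIso ⊤).inv from congr(($key).hom)
  rw [Scheme.ΓSpecIso_inv_naturality_assoc, Iso.inv_comp_eq, Iso.hom_inv_id_assoc,
    Iso.inv_comp_eq, ← Category.assoc, Iso.eq_comp_inv, Scheme.Hom.appIso_hom',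
    Scheme.Hom.appIso_hom']
  subst h
  rw [Scheme.Hom.map_appLE]
  exact (Scheme.Hom.appLE_comp_appLE (Spec.map φ) c (c ''ᵁ ⊤) ⊤ ⊤
    (c.preimage_image_eq ⊤).ge le_top).symm.trans
    congr(_ ≫ $((Scheme.Hom.app_eq_appLE (Spec.map φ) (U := ⊤)).symm))

theorem map_germHom_map_chartHom (K : Ideal R) {y : Y} (hy : y ∈ d ''ᵁ ⊤) :
    (K.map (chartHom c)).map (germHom (image_top_le_of_factors φ h hy)) =
      ((K.map φ.hom).map (chartHom d)).map (germHom hy) := by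
  rw [← germHom_comp_resHom (image_top_le_of_factors φ h) hy, Ideal.map_map, Ideal.map_map,
    Ideal.map_map, RingHom.comp_assoc, resHom_comp_chartHom φ h, RingHom.comp_assoc]

end Subchart

section Cover

variable {ι : Type*} {R : ι → CommRingCat.{u}} (c : ∀ i, Spec (R i) ⟶ Y)
  [∀ i, IsOpenImmersion (c i)] (hc : ∀ y, ∃ i, y ∈ Set.range (c i))
include hc

theorem iSup_image_eq_top : ⨆ i, c i ''ᵁ ⊤ = ⊤ := by
  refine eq_top_iff.mpr fun y _ ↦ ?_
  obtain ⟨i, x, rfl⟩ := hc y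
  exact TopologicalSpace.Opens.mem_iSup.mpr ⟨i, x, trivial, rfl⟩

theorem le_iff_onSpec_le {I J : Y.IdealSheafData} :
    I ≤ J ↔ ∀ i, onSpec I (c i) ≤ onSpec J (c i) := by
  refine ⟨fun h i ↦ onSpec_mono h _, fun h ↦ Scheme.IdealSheafData.le_of_iSup_eq_top
    (fun i ↦ ⟨c i ''ᵁ ⊤, isAffineOpen_image (c i)⟩) (iSup_image_eq_top c hc) fun i ↦ ?_⟩
  rw [← map_chartHom_onSpec, ← map_chartHom_onSpec]
  exact Ideal.map_mono (h i)

theorem exists_onSpec_eq (K : ∀ i, Ideal (R i))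
    (hK : ∀ i j, ∀ y ∈ Set.range (c i), y ∈ Set.range (c j) →
      ∃ (S : CommRingCat.{u}) (d : Spec S ⟶ Y) (_ : IsOpenImmersion d)
        (φ : R i ⟶ S) (ψ : R j ⟶ S), d = Spec.map φ ≫ c i ∧ d = Spec.map ψ ≫ c j ∧
        y ∈ Set.range d ∧ (K i).map φ.hom ≤ (K j).map ψ.hom) :
    ∃ J : Y.IdealSheafData, ∀ i, onSpec J (c i) = K i := by
  have hgerm i j y (hi : y ∈ c i ''ᵁ ⊤) (hj : y ∈ c j ''ᵁ ⊤) :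
      ((K i).map (chartHom (c i))).map (germHom hi) ≤
        ((K j).map (chartHom (c j))).map (germHom hj) := by
    have ⟨z, _, hz⟩ := hi
    have ⟨w, _, hw⟩ := hj
    obtain ⟨S, d, _, φ, ψ, hφ, hψ, ⟨x, hx⟩, hle⟩ := hK i j y ⟨z, hz⟩ ⟨w, hw⟩
    have hy : y ∈ d ''ᵁ ⊤ := ⟨x, trivial, hx⟩
    rw [map_germHom_map_chartHom φ hφ (K i) hy, map_germHom_map_chartHom ψ hψ (K j) hy]
    exact Ideal.map_mono (Ideal.map_mono hle)
  obtain ⟨J, hJ⟩ := exists_idealSheafData_ideal_eq (fun i ↦ isAffineOpen_image (c i))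
    (iSup_image_eq_top c hc) _ hgerm
  refine ⟨J, fun i ↦ ?_⟩
  rw [onSpec_eq_comap_chartHom, hJ i]
  exact Ideal.comap_map_of_bijective _ (chartHom_bijective _)

theorem exists_away_factors {B : CommRingCat.{u}} (w : Spec B ⟶ Y) :
    ∃ s : Set B, Ideal.span s = ⊤ ∧ ∀ r ∈ s, ∃ (i : ι) (ψ : R i ⟶ .of (Localization.Away r)),
      Spec.map (CommRingCat.ofHom (algebraMap B (Localization.Away r))) ≫ w =
        Spec.map ψ ≫ c i := by
  have hloc (x : Spec B) : ∃ (i : ι) (r : B), x ∈ PrimeSpectrum.basicOpen r ∧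
      (PrimeSpectrum.basicOpen r : Set (PrimeSpectrum B)) ⊆ w ⁻¹' Set.range (c i) := by
    obtain ⟨i, hi⟩ := hc (w x)
    obtain ⟨_, ⟨r, rfl⟩, hxr, hr⟩ := PrimeSpectrum.isTopologicalBasis_basic_opens
      |>.exists_subset_of_mem_open (show x ∈ w ⁻¹' Set.range (c i) from hi)
      ((c i).isOpenEmbedding.isOpen_range.preimage w.continuous)
    exact ⟨i, r, hxr, hr⟩
  choose i r hxr hr using hloc
  refine ⟨Set.range r, ?_, ?_⟩
  · rw [← PrimeSpectrum.iSup_basicOpen_eq_top_iff, eq_top_iff]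
    exact fun x _ ↦ TopologicalSpace.Opens.mem_iSup.mpr ⟨x, hxr x⟩
  · rintro _ ⟨x, rfl⟩
    set w' := Spec.map (CommRingCat.ofHom (algebraMap B (Localization.Away (r x)))) ≫ w
    have hrange : Set.range w' ⊆ Set.range (c (i x)) := by
      rintro _ ⟨z, rfl⟩
      refine hr x ?_
      exact (PrimeSpectrum.localization_away_comap_range (Localization.Away (r x)) (r x)).le
        ⟨z, rfl⟩
    exact ⟨i x, Spec.preimage (IsOpenImmersion.lift (c (i x)) w' hrange), by
      rw [Spec.map_preimage, IsOpenImmersion.lift_fac]⟩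

end Cover

end Charts

section SingularAlong

open KaehlerDifferential

/-- The closed subscheme of `Spec R` cut out by `I` is singular along the one cut out by `J`: the
latter is contained in it and the conormal map `f ↦ df` vanishes there. The structure map `ρ` is a
bare ring homomorphism because sections over an open subscheme carry no canonical algebra
structure over the base. -/
def IsSingularAlong {k R : Type*} [CommRing k] [CommRing R] (ρ : k →+* R) (I J : Ideal R) : Prop :=
  I ≤ J ∧ ∀ f ∈ I, letI := ρ.toAlgebra; D k R f ∈ J • (⊤ : Submodule R Ω[R⁄k])

variable {k R : Type*} [CommRing k] [CommRing R]

theorem isSingularAlong_span_iff {ρ : k →+* R} {s : Set R} {J : Ideal R} :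
    IsSingularAlong ρ (Ideal.span s) J ↔
      s ⊆ J ∧ ∀ f ∈ s, letI := ρ.toAlgebra; D k R f ∈ J • (⊤ : Submodule R Ω[R⁄k]) := by
  let := ρ.toAlgebra
  refine ⟨fun h ↦ ⟨Ideal.span_le.mp h.1, fun f hf ↦ h.2 f (Ideal.subset_span hf)⟩,
    fun h ↦ ⟨Ideal.span_le.mpr h.1, fun f hf ↦ ?_⟩⟩
  induction hf using Submodule.span_induction with
  | mem f hf => exact h.2 f hf
  | zero => rw [map_zero]; exact zero_mem _
  | add f g _ _ hf hg => rw [map_add]; exact add_mem hf hg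
  | smul a f hf ih =>
    rw [smul_eq_mul, Derivation.leibniz]
    exact add_mem (Submodule.smul_mem _ _ ih)
      (Submodule.smul_mem_smul (Ideal.span_le.mpr h.1 hf) trivial)

theorem smul_top_le_comap_map {M M' S : Type*} [CommRing S] [Algebra R S] [AddCommGroup M]
    [Module R M] [AddCommGroup M'] [Module R M'] [Module S M'] [IsScalarTower R S M']
    (ψ : M →ₗ[R] M') (J : Ideal R) :
    J • (⊤ : Submodule R M) ≤
      ((J.map (algebraMap R S) • (⊤ : Submodule S M')).restrictScalars R).comap ψ :=
  Submodule.smul_le.mpr fun r hr x _ ↦ by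
    have hψ : ψ (r • x) = algebraMap R S r • ψ x := by rw [map_smul, algebraMap_smul]
    rw [Submodule.mem_comap, Submodule.restrictScalars_mem, hψ]
    exact Submodule.smul_mem_smul (Ideal.mem_map_of_mem _ hr) trivial

theorem IsSingularAlong.map {S : Type*} [CommRing S] {ρ : k →+* R} {I J : Ideal R}
    (h : IsSingularAlong ρ I J) (φ : R →+* S) :
    IsSingularAlong (φ.comp ρ) (I.map φ) (J.map φ) := by
  let := ρ.toAlgebra
  let := φ.toAlgebra
  let := (φ.comp ρ).toAlgebra
  have : IsScalarTower k R S := .of_algebraMap_eq' rfl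
  refine isSingularAlong_span_iff.mpr ⟨?_, ?_⟩
  · exact (Set.image_mono h.1).trans Ideal.subset_span
  · rintro _ ⟨f, hf, rfl⟩
    exact map_D k k R S f ▸ smul_top_le_comap_map (KaehlerDifferential.map k k R S) J (h.2 f hf)

theorem mem_smul_top_of_span {M : Type*} [AddCommGroup M] [Module R M] {J : Ideal R} {x : M}
    {s : Set R} (hs : Ideal.span s = ⊤) {R' M' : s → Type*} [∀ r, CommRing (R' r)]
    [∀ r, Algebra R (R' r)] [∀ r, IsLocalization.Away r.1 (R' r)] [∀ r, AddCommGroup (M' r)]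
    [∀ r, Module R (M' r)] [∀ r, Module (R' r) (M' r)] [∀ r, IsScalarTower R (R' r) (M' r)]
    (ψ : ∀ r, M →ₗ[R] M' r) [∀ r, IsLocalizedModule.Away r.1 (ψ r)]
    (h : ∀ r, ψ r x ∈ J.map (algebraMap R (R' r)) • (⊤ : Submodule (R' r) (M' r))) :
    x ∈ J • (⊤ : Submodule R M) := by
  refine Submodule.mem_of_isLocalized_span s hs M' ψ fun r ↦ ?_
  rw [← Submodule.restrictScalars_localized' (R' r), Submodule.restrictScalars_mem,
    Submodule.localized'_smul, Submodule.localized'_top, Ideal.localized'_eq_map]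
  exact h r

theorem isSingularAlong_of_span {ρ : k →+* R} {I J : Ideal R} {s : Set R}
    (hs : Ideal.span s = ⊤) (R' : s → Type*) [∀ r, CommRing (R' r)] [∀ r, Algebra R (R' r)]
    [∀ r, IsLocalization.Away r.1 (R' r)]
    (h : ∀ r, IsSingularAlong ((algebraMap R (R' r)).comp ρ) (I.map (algebraMap R _))
      (J.map (algebraMap R _))) :
    IsSingularAlong ρ I J := by
  let := ρ.toAlgebra
  let (r : s) : Algebra k (R' r) := ((algebraMap R _).comp ρ).toAlgebra
  have (r : s) : IsScalarTower k R (R' r) := .of_algebraMap_eq' rfl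
  refine ⟨fun f hf ↦ ?_, fun f hf ↦ mem_smul_top_of_span hs (R' := R')
    (fun r ↦ KaehlerDifferential.map k k R (R' r)) fun r ↦ ?_⟩
  · rw [← J.mul_top, ← smul_eq_mul]
    refine mem_smul_top_of_span hs (R' := R') (fun r ↦ Algebra.linearMap R (R' r)) fun r ↦ ?_
    rw [smul_eq_mul, Ideal.mul_top]
    exact (h r).1 (Ideal.mem_map_of_mem _ hf)
  · rw [map_D]
    exact (h r).2 _ (Ideal.mem_map_of_mem _ hf)

end SingularAlong

section SingularCharts

variable {k : Type u} [CommRing k] {Y : Scheme.{u}} {q : Y ⟶ Spec (.of k)}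

theorem fromSpec_comp (q : Y ⟶ Spec (.of k)) {W : Y.Opens} (hW : IsAffineOpen W) :
    letI := sectionsAlgebra q W
    hW.fromSpec ≫ q = Spec.map (CommRingCat.ofHom (algebraMap k Γ(Y, W))) := by
  have h := IsAffineOpen.SpecMap_appLE_fromSpec q (isAffineOpen_top (Spec (.of k))) hW le_top
  rw [← h, IsAffineOpen.fromSpec_top, Scheme.isoSpec_Spec_inv, ← Spec.map_comp]
  rfl

variable {ι : Type*} {R : ι → CommRingCat.{u}} {c : ∀ i, Spec (R i) ⟶ Y}
  [∀ i, IsOpenImmersion (c i)] (hc : ∀ y, ∃ i, y ∈ Set.range (c i))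
  {ρ : ∀ i, k →+* R i} (hρ : ∀ i, c i ≫ q = Spec.map (CommRingCat.ofHom (ρ i)))
include hc hρ

theorem isSingularAlong_onSpec_of_cover {I J : Y.IdealSheafData}
    (h : ∀ i, IsSingularAlong (ρ i) (onSpec I (c i)) (onSpec J (c i))) {B : CommRingCat.{u}}
    {w : Spec B ⟶ Y} {σ : k →+* B} (hσ : w ≫ q = Spec.map (CommRingCat.ofHom σ)) :
    IsSingularAlong σ (onSpec I w) (onSpec J w) := by
  obtain ⟨s, hs, hfactor⟩ := exists_away_factors c hc w
  refine isSingularAlong_of_span hs (fun r ↦ Localization.Away r.1) fun r ↦ ?_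
  obtain ⟨i, ψ, hψ⟩ := hfactor r r.2
  have hring : ψ.hom.comp (ρ i) = (algebraMap B (Localization.Away r.1)).comp σ := by
    have h := congrArg (· ≫ q) hψ
    simp only [Category.assoc, hσ, hρ, ← Spec.map_comp] at h
    exact congrArg CommRingCat.Hom.hom (Spec.map_injective h).symm
  have hloc (X : Y.IdealSheafData) :
      (onSpec X w).map (algebraMap B (Localization.Away r.1)) = (onSpec X (c i)).map ψ.hom := by
    rw [← onSpec_SpecMap_comp ψ, ← hψ, onSpec_SpecMap_comp, CommRingCat.hom_ofHom]
  rw [hloc, hloc, ← hring]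
  exact (h i).map ψ.hom

theorem singularityIdeal_eq_sInf (I : Y.IdealSheafData) : singularityIdeal q I =
    sInf {J | ∀ i, IsSingularAlong (ρ i) (onSpec I (c i)) (onSpec J (c i))} := by
  have hideal (J : Y.IdealSheafData) (W : Y.affineOpens) : onSpec J W.2.fromSpec = J.ideal W :=
    onSpec_fromSpec J W.2
  refine congrArg sInf (Set.ext fun J ↦ ?_)
  trans ∀ W : Y.affineOpens, IsSingularAlong
    ((Scheme.ΓSpecIso (.of k)).inv ≫ q.appLE ⊤ W le_top).hom
    (onSpec I W.2.fromSpec) (onSpec J W.2.fromSpec)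
  · simp only [hideal]
    exact forall_and.symm
  have hcover (y : Y) : ∃ W : Y.affineOpens, y ∈ Set.range W.2.fromSpec := by
    obtain ⟨W, hW, hy, -⟩ := exists_isAffineOpen_mem_and_subset (U := ⊤) (x := y) trivial
    exact ⟨⟨W, hW⟩, hW.range_fromSpec.ge hy⟩
  have (W : Y.affineOpens) : IsOpenImmersion W.2.fromSpec := W.2.isOpenImmersion_fromSpec
  exact ⟨fun h i ↦
      isSingularAlong_onSpec_of_cover hcover (fun W ↦ fromSpec_comp q W.2) h (hρ i),
    fun h W ↦ isSingularAlong_onSpec_of_cover hc hρ h (fromSpec_comp q W.2)⟩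

end SingularCharts

section SquareZero

open TrivSqZeroExt

variable {k A R M : Type*} [CommRing k] [CommRing A] [CommRing R] [AddCommGroup M] [Algebra k A]
  [Algebra k R] [Algebra A R] [Module k M] [Module A M] [Module R M] [Module Rᵐᵒᵖ M]
  [IsCentralScalar R M]

/-- The ring homomorphism `a ↦ a + ε d a` to the square-zero extension of `R` by `M` given by a
derivation `d`. -/
def derivationToTrivSqZeroExt [IsScalarTower A R M] (d : Derivation k A M) :
    A →+* TrivSqZeroExt R M where
  toFun a := inl (algebraMap A R a) + inr (d a)
  map_one' := by simp
  map_zero' := by simp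
  map_add' a b := by ext <;> simp
  map_mul' a b := by ext <;> simp

theorem exists_derivation_of_fst_eq [IsScalarTower k R M] (F : R →+* TrivSqZeroExt R M)
    (hF : ∀ x, (F x).fst = x) (hk : ∀ c, (F (algebraMap k R c)).snd = 0) :
    ∃ D : Derivation k R M, ∀ x, D x = (F x).snd := by
  have hmul (x y : R) : (F (x * y)).snd = x • (F y).snd + y • (F x).snd := by
    rw [map_mul, snd_mul, hF, hF, op_smul_eq_smul]
  exact ⟨.mk'
    { toFun x := (F x).snd
      map_add' x y := by rw [map_add, snd_add]
      map_smul' c x := by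
        rw [Algebra.smul_def, hmul, hk, smul_zero, add_zero, algebraMap_smul, RingHom.id_apply] }
    hmul, fun _ ↦ rfl⟩

end SquareZero

section ChartProperty

variable {A N : Type*} [CommRing A] [AddCommGroup N] [Module A N] {R : Type u} [CommRing R]
  [Algebra A R]

/-- The universal property of the ring of functions `q m = m / l` on the chart `l ≠ 0`: its
homomorphisms to `B` over `A → B` are the semilinear maps `N → B` sending `l` to `1`. The
differential calculus on a chart is derived from it, without unfolding homogeneous
localizations. -/
structure IsChart (l : N) (q : N →ₗ[A] R) : Prop where
  apply_self : q l = 1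
  exists_lift {B : Type u} [CommRing B] {φ : A →+* B} (g : N →ₛₗ[φ] B) (hg : g l = 1) :
    ∃ F : R →+* B, (∀ a, F (algebraMap A R a) = φ a) ∧ ∀ m, F (q m) = g m
  hom_ext {B : Type u} [CommRing B] {F G : R →+* B}
    (h₀ : ∀ a, F (algebraMap A R a) = G (algebraMap A R a)) (h₁ : ∀ m, F (q m) = G (q m)) : F = G

variable {k : Type*} [CommRing k] [Algebra k A] [Algebra k R] [IsScalarTower k A R] {l : N}
  {q : N →ₗ[A] R}

theorem IsChart.exists_derivation (hq : IsChart l q) {M : Type u} [AddCommGroup M] [Module k M]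
    [Module A M] [Module R M] [IsScalarTower A R M] [IsScalarTower k R M] (d : Derivation k A M)
    (e : N →+ M) (he : ∀ (a : A) (m : N), e (a • m) = a • e m + q m • d a) :
    ∃ D : Derivation k R M, ∀ m, D (q m) = e m - q m • e l := by
  let : Module Rᵐᵒᵖ M := Module.compHom M ((RingHom.id R).fromOpposite mul_comm)
  have : IsCentralScalar R M := ⟨fun _ _ ↦ rfl⟩
  let g : N →ₛₗ[derivationToTrivSqZeroExt (R := R) d] TrivSqZeroExt R M :=
    { toFun m := .inl (q m) + .inr (e m - q m • e l)
      map_add' m m' := by ext <;> simp [add_smul, add_sub_add_comm]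
      map_smul' a m := by
        ext
        · simp [derivationToTrivSqZeroExt, Algebra.smul_def]
        · simp [derivationToTrivSqZeroExt, he, smul_sub, smul_assoc, add_sub_right_comm] }
  have hgl : g l = 1 := by ext <;> simp [g, hq.apply_self]
  obtain ⟨F, hFA, hFq⟩ := hq.exists_lift g hgl
  have hfst : (TrivSqZeroExt.fstHom R R M : TrivSqZeroExt R M →+* R).comp F = RingHom.id R :=
    hq.hom_ext (fun a ↦ by simp [hFA, derivationToTrivSqZeroExt]) fun m ↦ by simp [hFq, g]
  obtain ⟨D, hD⟩ := exists_derivation_of_fst_eq (k := k) F (RingHom.congr_fun hfst) fun c ↦ by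
    simp [IsScalarTower.algebraMap_apply k A R, hFA, derivationToTrivSqZeroExt]
  exact ⟨D, fun m ↦ by simp [hD, hFq, g]⟩

variable {ι : Type*} [Fintype ι] (b : Module.Basis ι A N)

theorem map_eq_sum_coord {M : Type*} [AddCommGroup M] [Module A M] (q : N →ₗ[A] M) (m : N) :
    q m = ∑ j, b.coord j m • q (b j) := by
  conv_lhs => rw [← b.sum_repr m, map_sum]
  simp only [map_smul, Module.Basis.coord_apply]

theorem IsChart.exists_derivation_of_basis (hq : IsChart l q) {M : Type u} [AddCommGroup M]
    [Module k M] [Module A M] [Module R M] [IsScalarTower A R M] [IsScalarTower k R M]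
    (d : Derivation k A M) : ∃ D : Derivation k R M, ∀ m,
      D (q m) = ∑ j, q (b j) • d (b.coord j m) - q m • ∑ j, q (b j) • d (b.coord j l) := by
  let e : N →+ M := ∑ j, (DistribSMul.toAddMonoidHom M (q (b j))).comp
    (d.toLinearMap.toAddMonoidHom.comp (b.coord j).toAddMonoidHom)
  have he (m : N) : e m = ∑ j, q (b j) • d (b.coord j m) := by simp [e]
  obtain ⟨D, hD⟩ := hq.exists_derivation d e fun a m ↦ by
    simp only [he, map_smul, smul_eq_mul, Derivation.leibniz, smul_add, Finset.sum_add_distrib,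
      map_eq_sum_coord b q m, Finset.smul_sum, Finset.sum_smul, smul_assoc]
    congr 1 <;> exact Finset.sum_congr rfl fun j _ ↦ smul_comm _ _ _
  exact ⟨D, fun m ↦ by rw [hD, he, he]⟩

theorem derivation_mem_smul_top {R M : Type*} [CommRing R] [Algebra k R] [AddCommGroup M]
    [Module k M] [Module R M] [IsScalarTower k R M] (D : Derivation k R M) {J : Ideal R} {f : R}
    (hf : KaehlerDifferential.D k R f ∈ J • (⊤ : Submodule R Ω[R⁄k])) :
    D f ∈ J • (⊤ : Submodule R M) := by
  rw [← D.liftKaehlerDifferential_comp_D]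
  exact Submodule.smul_mono le_rfl le_top
    (Submodule.map_smul'' J ⊤ D.liftKaehlerDifferential ▸ Submodule.mem_map_of_mem hf)

theorem IsChart.algebraMap_dual_mem (hq : IsChart l q) {J : Ideal R} {m : N} (hm : q m ∈ J)
    (hd : KaehlerDifferential.D k R (q m) ∈ J • (⊤ : Submodule R Ω[R⁄k]))
    (t : Module.Dual A N) : algebraMap A R (t m) ∈ J := by
  obtain ⟨D, hD⟩ := hq.exists_derivation (k := k) 0
    (((Algebra.linearMap A R).comp t).toAddMonoidHom) fun a m ↦ by simp [Algebra.smul_def]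
  have hDm : D (q m) ∈ J := by simpa using! derivation_mem_smul_top D hd
  simpa [hD] using! J.add_mem hDm (J.mul_mem_right (algebraMap A R (t l)) hm)

end ChartProperty

section KaehlerModMap

variable {k A R : Type*} [CommRing k] [CommRing A] [CommRing R] [Algebra k A] [Algebra k R]
  [Algebra A R] [IsScalarTower k A R] {I : Ideal A} {J : Ideal R}

/-- The map `r ⊗ (1 ⊗ da) ↦ r da` of pullbacks of cotangent modules induced by a morphism from the
subscheme defined by `J` to the subscheme defined by `I`. -/
noncomputable def kaehlerModMap (hIJ : I.map (algebraMap A R) ≤ J) :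
    R ⊗[A] ((A ⧸ I) ⊗[A] Ω[A⁄k]) →ₗ[R] Ω[R⁄k] ⧸ (J • ⊤ : Submodule R Ω[R⁄k]) :=
  ((Submodule.liftQ (I • ⊤)
    (((J • ⊤ : Submodule R Ω[R⁄k]).mkQ.restrictScalars A).comp (KaehlerDifferential.map k k A R))
    (Submodule.smul_le.mpr fun a ha x _ ↦ by
      rw [LinearMap.mem_ker, map_smul, ← algebraMap_smul R a]
      exact Module.isTorsionBySet_quotient_ideal_smul _ J
        (a := ⟨algebraMap A R a, hIJ (Ideal.mem_map_of_mem _ ha)⟩))).comp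
    (TensorProduct.quotTensorEquivQuotSMul Ω[A⁄k] I).toLinearMap).liftBaseChange R

theorem kaehlerModMap_tmul_one_tmul_D (hIJ : I.map (algebraMap A R) ≤ J) (r : R) (a : A) :
    kaehlerModMap (k := k) hIJ (r ⊗ₜ (1 ⊗ₜ KaehlerDifferential.D k A a)) =
      Submodule.Quotient.mk (r • KaehlerDifferential.D k R (algebraMap A R a)) := by
  rw [kaehlerModMap, LinearMap.liftBaseChange_tmul]
  simp

theorem kaehlerModMap_eq_zero_of_mem_smul_top (hIJ : I.map (algebraMap A R) ≤ J)
    {x : R ⊗[A] ((A ⧸ I) ⊗[A] Ω[A⁄k])} (hx : x ∈ J • (⊤ : Submodule R _)) :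
    kaehlerModMap hIJ x = 0 := by
  suffices h : J • ⊤ ≤ LinearMap.ker (kaehlerModMap (k := k) hIJ) from h hx
  refine Submodule.smul_le.mpr fun r hr y _ ↦ ?_
  rw [LinearMap.mem_ker, map_smul]
  exact Module.isTorsionBySet_quotient_ideal_smul _ J (a := ⟨r, hr⟩)

end KaehlerModMap

section TyurinaChart

variable {k A N R : Type u} [CommRing k] [CommRing A] [CommRing R] [AddCommGroup N] [Algebra k A]
  [Algebra k R] [Algebra A R] [IsScalarTower k A R] [Module A N] {l m : N} {q : N →ₗ[A] R}
  {ι : Type*} [Fintype ι] (b : Module.Basis ι A N) {I : Ideal A} {J : Ideal R}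

variable (k) in
omit [Algebra k R] [IsScalarTower k A R] in
theorem baseChange_dualToKaehler_sum_coord (q : N →ₗ[A] R) (hI : ∀ t : Module.Dual A N, t m ∈ I) :
    (dualToKaehler A k I m hI).baseChange R (∑ j, q (b j) ⊗ₜ b.coord j) =
      ∑ j, q (b j) ⊗ₜ (1 ⊗ₜ KaehlerDifferential.D k A (b.coord j m)) := by
  rw [map_sum]
  rfl

theorem IsChart.baseChange_dualToKaehler_mem (hq : IsChart l q)
    (hI : ∀ t : Module.Dual A N, t m ∈ I) (hm : q m ∈ J)
    (hd : KaehlerDifferential.D k R (q m) ∈ J • (⊤ : Submodule R Ω[R⁄k])) :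
    (dualToKaehler A k I m hI).baseChange R (∑ j, q (b j) ⊗ₜ b.coord j) ∈
      J • (⊤ : Submodule R (R ⊗[A] ((A ⧸ I) ⊗[A] Ω[A⁄k]))) := by
  obtain ⟨D, hD⟩ := hq.exists_derivation_of_basis b
    (((TensorProduct.mk A R _ 1).comp (TensorProduct.mk A (A ⧸ I) Ω[A⁄k] 1)).compDer
      (KaehlerDifferential.D k A))
  have hsum (n : N) : ∑ j, q (b j) • ((TensorProduct.mk A R _ 1).comp
      (TensorProduct.mk A (A ⧸ I) Ω[A⁄k] 1)).compDer (KaehlerDifferential.D k A) (b.coord j n) =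
      ∑ j, q (b j) ⊗ₜ (1 ⊗ₜ KaehlerDifferential.D k A (b.coord j n)) :=
    Finset.sum_congr rfl fun j _ ↦ by simp [TensorProduct.smul_tmul']
  have hDm := derivation_mem_smul_top D hd
  rw [hD, hsum, ← baseChange_dualToKaehler_sum_coord k b q hI] at hDm
  exact (Submodule.sub_mem_iff_left _ (Submodule.smul_mem_smul hm Submodule.mem_top)).mp hDm

theorem D_mem_of_baseChange_dualToKaehler_mem (hI : ∀ t : Module.Dual A N, t m ∈ I)
    (hIJ : I.map (algebraMap A R) ≤ J)
    (h : (dualToKaehler A k I m hI).baseChange R (∑ j, q (b j) ⊗ₜ b.coord j) ∈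
      J • (⊤ : Submodule R (R ⊗[A] ((A ⧸ I) ⊗[A] Ω[A⁄k])))) :
    KaehlerDifferential.D k R (q m) ∈ J • (⊤ : Submodule R Ω[R⁄k]) := by
  have hsum : ∑ j, q (b j) • KaehlerDifferential.D k R (algebraMap A R (b.coord j m)) ∈
      J • (⊤ : Submodule R Ω[R⁄k]) := by
    have := kaehlerModMap_eq_zero_of_mem_smul_top hIJ h
    rw [baseChange_dualToKaehler_sum_coord, map_sum] at this
    simp only [kaehlerModMap_tmul_one_tmul_D, ← Submodule.mkQ_apply] at this
    rwa [← map_sum, Submodule.mkQ_apply, Submodule.Quotient.mk_eq_zero] at this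
  have hD : KaehlerDifferential.D k R (q m) =
      ∑ j, algebraMap A R (b.coord j m) • KaehlerDifferential.D k R (q (b j)) +
        ∑ j, q (b j) • KaehlerDifferential.D k R (algebraMap A R (b.coord j m)) := by
    simp only [map_eq_sum_coord b q m, Algebra.smul_def, map_sum, Derivation.leibniz,
      Finset.sum_add_distrib]
  rw [hD]
  exact add_mem (sum_mem fun j _ ↦
    Submodule.smul_mem_smul (hIJ (Ideal.mem_map_of_mem _ (hI _))) trivial) hsum

omit [Algebra k R] [IsScalarTower k A R] in
theorem IsChart.isSingularAlong_iff (hq : IsChart l q)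
    (hI : ∀ t : Module.Dual A N, t m ∈ I) (hI' : I ≤ LinearMap.range (Module.Dual.eval A N m)) :
    IsSingularAlong ((algebraMap A R).comp (algebraMap k A)) (Ideal.span {q m}) J ↔
      I.map (algebraMap A R) ≤ J ∧
        (dualToKaehler A k I m hI).baseChange R (∑ j, q (b j) ⊗ₜ b.coord j) ∈
          J • (⊤ : Submodule R (R ⊗[A] ((A ⧸ I) ⊗[A] Ω[A⁄k]))) := by
  let : Algebra k R := ((algebraMap A R).comp (algebraMap k A)).toAlgebra
  have : IsScalarTower k A R := .of_algebraMap_eq' rfl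
  simp only [isSingularAlong_span_iff, Set.singleton_subset_iff, Set.mem_singleton_iff, forall_eq]
  refine ⟨fun ⟨hm, hd⟩ ↦ ⟨Ideal.map_le_iff_le_comap.mpr fun a ha ↦ ?_,
    hq.baseChange_dualToKaehler_mem b hI hm hd⟩, fun ⟨hIJ, h⟩ ↦
    ⟨?_, D_mem_of_baseChange_dualToKaehler_mem b hI hIJ h⟩⟩
  · obtain ⟨t, rfl⟩ := hI' ha
    exact hq.algebraMap_dual_mem hm hd t
  · rw [map_eq_sum_coord b q m]
    simp only [Algebra.smul_def]
    exact sum_mem fun j _ ↦ J.mul_mem_right _ (hIJ (Ideal.mem_map_of_mem _ (hI _)))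

end TyurinaChart

section ChartRing

open SymmetricAlgebra

variable {A N : Type u} [CommRing A] [AddCommGroup N] [Module A N]

theorem val_mk_mul_pow {l : N} {n : ℕ} {x : SymmetricAlgebra A N} (hx : x ∈ gr A N (n • 1)) :
    (HomogeneousLocalization.Away.mk (gr A N) (iota_mem A N l) n x hx).val *
      algebraMap _ (Localization.Away (ι A N l)) (ι A N l) ^ n = algebraMap _ _ x := by
  rw [← map_pow, HomogeneousLocalization.Away.val_mk, Localization.mk_eq_mk']
  exact IsLocalization.mk'_spec _ x
    (⟨ι A N l ^ n, n, rfl⟩ : Submonoid.powers (ι A N l))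

theorem val_quot_mul (l m : N) : (quot A l m).val *
    algebraMap _ (Localization.Away (ι A N l)) (ι A N l) = algebraMap _ _ (ι A N m) := by
  simpa only [pow_one] using! val_mk_mul_pow (l := l) (n := 1) (iota_mem A N m)

theorem chartRing_ext {l : N} {x y : ChartRing A N l} (n : ℕ)
    (h : x.val * algebraMap _ (Localization.Away (ι A N l)) (ι A N l) ^ n =
      y.val * algebraMap _ _ (ι A N l) ^ n) : x = y :=
  HomogeneousLocalization.val_injective _
    (((IsLocalization.Away.algebraMap_isUnit (ι A N l)).pow n).mul_right_cancel h)

/-- The function `m / l` on the chart on which `l` does not vanish, as a linear map of `m`. -/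
noncomputable def quotLin (l : N) : N →ₗ[A] ChartRing A N l where
  toFun := quot A l
  map_add' m m' := chartRing_ext 1 <| by
    simp only [HomogeneousLocalization.val_add, pow_one, add_mul, val_quot_mul, map_add]
  map_smul' a m := chartRing_ext 1 <| by
    rw [RingHom.id_apply, HomogeneousLocalization.val_smul, pow_one, smul_mul_assoc, val_quot_mul,
      val_quot_mul, map_smul]
    exact map_smul (IsScalarTower.toAlgHom A _ (Localization.Away (ι A N l))) a _

theorem quot_self (l : N) : quot A l l = 1 :=
  chartRing_ext 1 <| by
    rw [pow_one, val_quot_mul, HomogeneousLocalization.val_one, one_mul]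

/-- Dehomogenization with respect to `l`, the substitution `l = 1`. -/
noncomputable def dehomogenize (l : N) : SymmetricAlgebra A N →ₐ[A] ChartRing A N l :=
  SymmetricAlgebra.lift (quotLin l)

theorem dehomogenize_iota (l m : N) : dehomogenize l (ι A N m) = quot A l m :=
  SymmetricAlgebra.lift_ι_apply _ _

theorem val_dehomogenize_mul_pow (l : N) {n : ℕ} {x : SymmetricAlgebra A N} (hx : x ∈ gr A N n) :
    (dehomogenize l x).val * algebraMap _ (Localization.Away (ι A N l)) (ι A N l) ^ n =
      algebraMap _ _ x := by
  induction hx using Submodule.pow_induction_on_left' with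
  | algebraMap a =>
    rw [AlgHom.commutes, pow_zero, mul_one]
    exact val_toAway _ _
  | add x y n _ _ hx hy =>
    rw [map_add, map_add, HomogeneousLocalization.val_add, add_mul, hx, hy]
  | mem_mul m hm n x _ ih =>
    obtain ⟨m, rfl⟩ := hm
    rw [map_mul, map_mul, HomogeneousLocalization.val_mul, dehomogenize_iota, pow_succ',
      mul_mul_mul_comm, val_quot_mul, ih]

theorem dehomogenize_surjective (l : N) : Function.Surjective (dehomogenize (A := A) l) := by
  intro z
  obtain ⟨n, x, hx, rfl⟩ := HomogeneousLocalization.Away.mk_surjective (gr A N) (iota_mem A N l) z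
  refine ⟨x, chartRing_ext n ?_⟩
  rw [val_mk_mul_pow, val_dehomogenize_mul_pow l (by simpa using! hx)]

theorem exists_chartRing_lift {B : Type u} [CommRing B] {φ : A →+* B} {l : N} (g : N →ₛₗ[φ] B)
    (hg : g l = 1) :
    ∃ F : ChartRing A N l →+* B, (∀ a, F (algebraMap A _ a) = φ a) ∧ ∀ m, F (quot A l m) = g m := by
  let := φ.toAlgebra
  let g' : N →ₗ[A] B :=
    { toFun := g
      map_add' := map_add g
      map_smul' a m := by rw [g.map_smulₛₗ, RingHom.id_apply, Algebra.smul_def]; rfl }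
  have hιg (m : N) : SymmetricAlgebra.lift g' (ι A N m) = g m := SymmetricAlgebra.lift_ι_apply _ _
  have hl : IsUnit ((SymmetricAlgebra.lift g').toRingHom (ι A N l)) := by
    simp [hιg, hg]
  let L := IsLocalization.Away.lift (S := Localization.Away (ι A N l)) (ι A N l) hl
  have hL (x) : L (algebraMap _ _ x) = SymmetricAlgebra.lift g' x :=
    IsLocalization.Away.lift_eq _ _ _
  refine ⟨L.comp (algebraMap (ChartRing A N l) (Localization.Away (ι A N l))),
    fun a ↦ ?_, fun m ↦ ?_⟩
  · refine (congrArg L (val_toAway _ a)).trans ?_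
    rw [hL, AlgHom.commutes]
    rfl
  · have := congrArg L (val_quot_mul l m)
    rwa [map_mul, hL, hL, hιg, hιg, hg, mul_one] at this

theorem chartRing_hom_ext {B : Type*} [CommRing B] {l : N} {F G : ChartRing A N l →+* B}
    (h₀ : ∀ a, F (algebraMap A _ a) = G (algebraMap A _ a))
    (h₁ : ∀ m, F (quot A l m) = G (quot A l m)) : F = G := by
  have h : F.comp (dehomogenize l).toRingHom = G.comp (dehomogenize l).toRingHom :=
    ringHom_ext (by simp [h₀]) (by simp [h₁, dehomogenize_iota])
  exact RingHom.ext ((dehomogenize_surjective l).forall.mpr (RingHom.congr_fun h))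

theorem isChart_quotLin (l : N) : IsChart l (quotLin (A := A) l) where
  apply_self := quot_self l
  exists_lift := exists_chartRing_lift
  hom_ext := chartRing_hom_ext

end ChartRing

section ChartMaps

variable {A N : Type u} [CommRing A] [AddCommGroup N] [Module A N]

theorem irrelevant_le_span_range_iota :
    (HomogeneousIdeal.irrelevant (gr A N)).toIdeal ≤
      Ideal.span (Set.range (SymmetricAlgebra.ι A N)) := by
  have h : HomogeneousIdeal.irrelevant (gr A N) ≤
      (⟨Ideal.span (Set.range (SymmetricAlgebra.ι A N)), Ideal.homogeneous_span _ _ (by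
        rintro _ ⟨l, rfl⟩
        exact ⟨1, iota_mem A N l⟩)⟩ : HomogeneousIdeal (gr A N)) := by
    rw [HomogeneousIdeal.irrelevant_le]
    intro d hd x hx
    obtain ⟨d, rfl⟩ := Nat.exists_eq_succ_of_ne_zero hd.ne'
    change x ∈ LinearMap.range (SymmetricAlgebra.ι A N) ^ (d + 1) at hx
    change x ∈ Ideal.span (Set.range (SymmetricAlgebra.ι A N))
    rw [pow_succ] at hx
    induction hx using Submodule.mul_induction_on' with
    | mem_mul_mem m _ n hn => exact Ideal.mul_mem_left _ _ (Ideal.subset_span hn)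
    | add x _ y _ hx hy => exact add_mem hx hy
  exact h

theorem exists_mem_basicOpen_iota (y : Proj (gr A N)) :
    ∃ l : N, y ∈ Proj.basicOpen (gr A N) (SymmetricAlgebra.ι A N l) := by
  have h := Proj.iSup_basicOpen_eq_top _ _ (irrelevant_le_span_range_iota (A := A) (N := N))
  rw [← TopologicalSpace.Opens.mem_iSup, h]
  trivial

theorem coe_opensRange_awayι {d : ℕ} (hd : 0 < d) (a : SymmetricAlgebra A N)
    (ha : a ∈ gr A N d) :
    Set.range (Proj.awayι (gr A N) a ha hd) = (Proj.basicOpen (gr A N) a : Set (Proj (gr A N))) :=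
  congr($(Proj.opensRange_awayι (gr A N) a ha hd).1)

variable {A' N' : Type u} [CommRing A'] [AddCommGroup N'] [Module A' N'] {σ : A' →+* A}
  {A'' N'' : Type u} [CommRing A''] [AddCommGroup N''] [Module A'' N''] {σ' : A'' →+* A}

/-- The ring homomorphism from the chart on which `l` does not vanish to a smaller chart of the base
change along `g`. -/
noncomputable def chartRingMap (g : N' →ₛₗ[σ] N) (l : N') {b x : SymmetricAlgebra A N}
    (hb : b ∈ gr A N 1) (hx : x = SymmetricAlgebra.ι A N (g l) * b) :
    ChartRing A' N' l →+* HomogeneousLocalization.Away (gr A N) x :=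
  (HomogeneousLocalization.awayMap (gr A N) hb
    (hx.trans (by rw [grMap_apply, symMap_iota]) :
      x = grMap g (SymmetricAlgebra.ι A' N' l) * b)).comp
  (HomogeneousLocalization.Away.map (grMap g) (SymmetricAlgebra.ι A' N' l))

theorem val_chartRingMap_quot (g : N' →ₛₗ[σ] N) (l m : N') {b x : SymmetricAlgebra A N}
    (hb : b ∈ gr A N 1) (hx : x = SymmetricAlgebra.ι A N (g l) * b) :
    (chartRingMap g l hb hx (quot A' l m)).val =
      Localization.mk (SymmetricAlgebra.ι A N (g m) * b) ⟨x, Submonoid.mem_powers x⟩ := by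
  rw [chartRingMap, RingHom.comp_apply, quot, HomogeneousLocalization.Away.map_mk,
    HomogeneousLocalization.awayMap_mk, HomogeneousLocalization.Away.val_mk]
  simp only [grMap_apply, symMap_iota, pow_one]

theorem chartRingMap_quot_dvd (g : N' →ₛₗ[σ] N) (g' : N'' →ₛₗ[σ'] N) (l m : N') (l' m' : N'')
    (h : g m = g' m') :
    chartRingMap g' l' (iota_mem A N (g l)) (mul_comm _ _) (quot A'' l' m') ∣
      chartRingMap g l (iota_mem A N (g' l')) rfl (quot A' l m) := by
  refine ⟨HomogeneousLocalization.Away.mk (gr A N)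
    (SetLike.mul_mem_graded (iota_mem A N (g l)) (iota_mem A N (g' l'))) 1
    (SymmetricAlgebra.ι A N (g' l') * SymmetricAlgebra.ι A N (g' l'))
    (SetLike.mul_mem_graded (iota_mem A N _) (iota_mem A N _)),
    HomogeneousLocalization.val_injective _ ?_⟩
  rw [HomogeneousLocalization.val_mul, val_chartRingMap_quot, val_chartRingMap_quot,
    HomogeneousLocalization.Away.val_mk, Localization.mk_mul, Localization.mk_eq_mk_iff,
    Localization.r_iff_exists]
  refine ⟨1, ?_⟩
  simp only [OneMemClass.coe_one, one_mul, Submonoid.coe_mul, pow_one, h]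
  ring

end ChartMaps

namespace VectorBundle

variable {V : Scheme.{u}} {n : ℕ} (E : VectorBundle V n)

/-- The inclusion of the part of the projective bundle over `U`. -/
noncomputable def projι (U : E.Patch) : Proj (gr Γ(V, U.opens) Γ(E.sheaf, U.opens)) ⟶ E.proj :=
  E.gluingData.cover.f U

instance (U : E.Patch) : IsOpenImmersion (E.projι U) :=
  E.gluingData.cover.map_prop U

theorem chart_eq (U : E.Patch) (l : Γ(E.sheaf, U.opens)) :
    E.chart U l = Proj.awayι (gr Γ(V, U.opens) Γ(E.sheaf, U.opens)) _ (iota_mem _ _ l) one_pos ≫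
      E.projι U := rfl

instance (U : E.Patch) (l : Γ(E.sheaf, U.opens)) : IsOpenImmersion (E.chart U l) := by
  rw [chart_eq]
  infer_instance

theorem projι_π (U : E.Patch) : E.projι U ≫ E.π =
    projToSpec Γ(V, U.opens) Γ(E.sheaf, U.opens) ≫ U.1.2.fromSpec := by
  rw [← IsAffineOpen.isoSpec_inv_ι, ← Category.assoc]
  exact E.gluingData.ι_toBase U

/-- The affine charts of the projective bundle, over all patches. -/
noncomputable abbrev charts (c : Σ U : E.Patch, Γ(E.sheaf, U.opens)) :
    Spec (.of (ChartRing Γ(V, c.1.opens) Γ(E.sheaf, c.1.opens) c.2)) ⟶ E.proj :=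
  E.chart c.1 c.2

theorem exists_mem_range_charts (y : E.proj) : ∃ c, y ∈ Set.range (E.charts c) := by
  obtain ⟨U, z, rfl⟩ : ∃ (U : E.Patch), y ∈ Set.range (E.projι U) :=
    ⟨_, E.gluingData.cover.covers y⟩
  obtain ⟨l, hl⟩ := exists_mem_basicOpen_iota (A := Γ(V, U.opens)) (N := Γ(E.sheaf, U.opens)) z
  obtain ⟨w, rfl⟩ := (coe_opensRange_awayι one_pos _ (iota_mem _ _ l)).ge hl
  exact ⟨⟨U, l⟩, w, rfl⟩

theorem chart_π (U : E.Patch) (l : Γ(E.sheaf, U.opens)) :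
    E.chart U l ≫ E.π = Spec.map (CommRingCat.ofHom (toAway Γ(V, U.opens) Γ(E.sheaf, U.opens)
      (SymmetricAlgebra.ι Γ(V, U.opens) _ l))) ≫ U.1.2.fromSpec := by
  rw [chart_eq, Category.assoc, projι_π, ← Category.assoc, awayι_projToSpec]

variable {E} in
/-- The inclusion of the part of the projective bundle over a smaller patch. -/
noncomputable abbrev projRes {U T : E.Patch} (h : T ≤ U) :
    Proj (gr Γ(V, T.opens) Γ(E.sheaf, T.opens)) ⟶ Proj (gr Γ(V, U.opens) Γ(E.sheaf, U.opens)) :=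
  Proj.map (grMap (res E.sheaf (Patch.le h))) (irrelevant_le _ (Patch.span_res h))

theorem projRes_projι {U T : E.Patch} (h : T ≤ U) : projRes h ≫ E.projι U = E.projι T :=
  E.gluingData.cover.trans_map (show (show E.gluingData.cover.I₀ from T) ⟶ U from
    homOfLE (X := E.Patch) h)

theorem awayι_comp_projι {U T : E.Patch} (h : T ≤ U) (l : Γ(E.sheaf, U.opens))
    {b x : SymmetricAlgebra Γ(V, T.opens) Γ(E.sheaf, T.opens)} (hb : b ∈ gr _ _ 1)
    (hx : x = SymmetricAlgebra.ι _ _ (res E.sheaf (Patch.le h) l) * b)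
    (hx2 : x ∈ gr Γ(V, T.opens) Γ(E.sheaf, T.opens) (1 + 1)) :
    Proj.awayι (gr Γ(V, T.opens) Γ(E.sheaf, T.opens)) x hx2 two_pos ≫ E.projι T =
      Spec.map (CommRingCat.ofHom (chartRingMap (res E.sheaf (Patch.le h)) l hb hx)) ≫
        E.chart U l := by
  rw [← E.projRes_projι h, ← Category.assoc, chart_eq, ← Category.assoc]
  congr 1
  rw [chartRingMap, CommRingCat.ofHom_comp, Spec.map_comp, Category.assoc,
    ← Proj.awayι_comp_map (grMap (res E.sheaf (Patch.le h)))
      (irrelevant_le _ (Patch.span_res h)) one_pos _ (iota_mem _ _ l), ← Category.assoc,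
    Proj.SpecMap_awayMap_awayι]

theorem exists_common_chart (U U' : E.Patch) (l : Γ(E.sheaf, U.opens)) (l' : Γ(E.sheaf, U'.opens))
    {y : E.proj} (hy : y ∈ Set.range (E.chart U l)) (hy' : y ∈ Set.range (E.chart U' l')) :
    ∃ (T : E.Patch) (h : T ≤ U) (h' : T ≤ U'),
      y ∈ Set.range (Proj.awayι (gr Γ(V, T.opens) Γ(E.sheaf, T.opens))
        (SymmetricAlgebra.ι _ _ (res E.sheaf (Patch.le h) l) *
          SymmetricAlgebra.ι _ _ (res E.sheaf (Patch.le h') l'))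
        (SetLike.mul_mem_graded (iota_mem _ _ _) (iota_mem _ _ _)) two_pos ≫
          E.projι T) := by
  obtain ⟨z, rfl⟩ := hy
  obtain ⟨z', hz'⟩ := hy'
  obtain ⟨T, h, h', w, hw, hw'⟩ := E.gluingData.cover.exists_of_f_eq_f (i := U) (j := U')
    (Proj.awayι (gr Γ(V, U.opens) Γ(E.sheaf, U.opens)) _ (iota_mem _ _ l) one_pos z)
    (Proj.awayι (gr Γ(V, U'.opens) Γ(E.sheaf, U'.opens)) _ (iota_mem _ _ l') one_pos z') hz'.symm
  change E.Patch at T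
  replace h : T ≤ U := leOfHom (X := E.Patch) h
  replace h' : T ≤ U' := leOfHom (X := E.Patch) h'
  replace hw : projRes h w = _ := hw
  replace hw' : projRes h' w = _ := hw'
  refine ⟨T, h, h', ?_⟩
  rw [Scheme.Hom.comp_base, TopCat.coe_comp, Set.range_comp, coe_opensRange_awayι,
    Proj.basicOpen_mul, TopologicalSpace.Opens.coe_inf]
  refine ⟨w, ⟨?_, ?_⟩, ?_⟩
  · rw [← symMap_iota]
    change projRes h w ∈ Proj.basicOpen _ _
    rw [hw]
    exact (coe_opensRange_awayι one_pos _ (iota_mem _ _ l)).le ⟨z, rfl⟩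
  · rw [← symMap_iota]
    change projRes h' w ∈ Proj.basicOpen _ _
    rw [hw']
    exact (coe_opensRange_awayι one_pos _ (iota_mem _ _ l')).le ⟨z', rfl⟩
  · rw [chart_eq, Scheme.Hom.comp_apply, ← hw, ← E.projRes_projι h]
    exact Scheme.Hom.comp_apply _ _ _

variable {E} in
theorem exists_chart_overlap (s : Γ(E.sheaf, ⊤)) {U U' : E.Patch} (l : Γ(E.sheaf, U.opens))
    (l' : Γ(E.sheaf, U'.opens)) {y : E.proj} (hy : y ∈ Set.range (E.chart U l))
    (hy' : y ∈ Set.range (E.chart U' l')) :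
    ∃ (S : CommRingCat.{u}) (d : Spec S ⟶ E.proj) (_ : IsOpenImmersion d)
      (φ : CommRingCat.of (ChartRing Γ(V, U.opens) Γ(E.sheaf, U.opens) l) ⟶ S)
      (ψ : CommRingCat.of (ChartRing Γ(V, U'.opens) Γ(E.sheaf, U'.opens) l') ⟶ S),
      d = Spec.map φ ≫ E.chart U l ∧ d = Spec.map ψ ≫ E.chart U' l' ∧ y ∈ Set.range d ∧
        ψ (quot Γ(V, U'.opens) l' (U'.sec s)) ∣ φ (quot Γ(V, U.opens) l (U.sec s)) := by
  obtain ⟨T, h, h', hT⟩ := E.exists_common_chart U U' l l' hy hy'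
  exact ⟨_, _, inferInstance, _, _,
    E.awayι_comp_projι h l (iota_mem _ _ (res E.sheaf (Patch.le h') l')) rfl _,
    E.awayι_comp_projι h' l' (iota_mem _ _ (res E.sheaf (Patch.le h) l)) (mul_comm _ _) _, hT,
    chartRingMap_quot_dvd _ _ _ _ _ _ ((res_res _ _ _ _).trans (res_res _ _ _ _).symm)⟩

theorem onSpec_hypersurfaceIdeal (s : Γ(E.sheaf, ⊤)) (U : E.Patch) (l : Γ(E.sheaf, U.opens)) :
    onSpec (E.hypersurfaceIdeal s) (E.chart U l) =
      Ideal.span {quot Γ(V, U.opens) l (U.sec s)} := by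
  obtain ⟨J, hJ⟩ := exists_onSpec_eq E.charts E.exists_mem_range_charts
    (fun c ↦ Ideal.span {quot Γ(V, c.1.opens) c.2 (c.1.sec s)}) fun c c' y hy hy' ↦ by
      obtain ⟨S, d, hd, φ, ψ, hφ, hψ, hyd, hdvd⟩ := exists_chart_overlap s c.2 c'.2 hy hy'
      refine ⟨S, d, hd, φ, ψ, hφ, hψ, hyd, ?_⟩
      simpa only [Ideal.map_span, Set.image_singleton, Ideal.span_singleton_le_span_singleton]
  suffices h : E.hypersurfaceIdeal s = J from h ▸ hJ ⟨U, l⟩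
  refine le_antisymm (sInf_le fun U l ↦ ?_) (le_sInf fun J' hJ' ↦ ?_)
  · exact (hJ ⟨U, l⟩).ge (Ideal.mem_span_singleton_self _)
  · refine (le_iff_onSpec_le E.charts E.exists_mem_range_charts).mpr fun c ↦ ?_
    rw [hJ c]
    exact (Ideal.span_singleton_le_iff_mem _).mpr (hJ' _ _)

theorem onSpec_comap_π (X : V.IdealSheafData) (U : E.Patch) (l : Γ(E.sheaf, U.opens)) :
    onSpec (X.comap E.π) (E.chart U l) = (X.ideal ⟨U.opens, U.1.2⟩).map (algebraMap Γ(V, U.opens)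
      (ChartRing Γ(V, U.opens) Γ(E.sheaf, U.opens) l)) := by
  rw [onSpec_comap, chart_π, onSpec_SpecMap_comp, onSpec_fromSpec]
  rfl

theorem comap_π_le_iff (X : V.IdealSheafData) (J : E.proj.IdealSheafData) :
    X.comap E.π ≤ J ↔ ∀ (U : E.Patch) (l : Γ(E.sheaf, U.opens)),
      (X.ideal ⟨U.opens, U.1.2⟩).map (algebraMap Γ(V, U.opens)
        (ChartRing Γ(V, U.opens) Γ(E.sheaf, U.opens) l)) ≤ onSpec J (E.chart U l) := by
  rw [le_iff_onSpec_le E.charts E.exists_mem_range_charts, Sigma.forall]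
  exact forall₂_congr fun U l ↦ by rw [onSpec_comap_π]

theorem chart_comp_π_comp {k : Type u} [CommRing k] (p : V ⟶ Spec (.of k)) (U : E.Patch)
    (l : Γ(E.sheaf, U.opens)) :
    letI := sectionsAlgebra p U.opens
    E.chart U l ≫ E.π ≫ p = Spec.map (CommRingCat.ofHom
      ((algebraMap Γ(V, U.opens) (ChartRing Γ(V, U.opens) Γ(E.sheaf, U.opens) l)).comp
        (algebraMap k Γ(V, U.opens)))) := by
  rw [← Category.assoc, chart_π, Category.assoc, fromSpec_comp, ← Spec.map_comp]
  rfl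

variable {E} {s : Γ(E.sheaf, ⊤)} {X : V.IdealSheafData}

theorem IsZeroScheme.isSingularAlong_chart_iff {k : Type u} [CommRing k] (p : V ⟶ Spec (.of k))
    (hX : E.IsZeroScheme s X) {U : E.Patch} {l : Γ(E.sheaf, U.opens)}
    (b : Module.Basis (Fin n) Γ(V, U.opens) Γ(E.sheaf, U.opens))
    (J : Ideal (ChartRing Γ(V, U.opens) Γ(E.sheaf, U.opens) l)) :
    letI := sectionsAlgebra p U.opens
    IsSingularAlong ((algebraMap Γ(V, U.opens) (ChartRing Γ(V, U.opens) Γ(E.sheaf, U.opens) l)).comp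
        (algebraMap k Γ(V, U.opens))) (onSpec (E.hypersurfaceIdeal s) (E.chart U l)) J ↔
      (X.ideal ⟨U.opens, U.1.2⟩).map (algebraMap Γ(V, U.opens)
          (ChartRing Γ(V, U.opens) Γ(E.sheaf, U.opens) l)) ≤ J ∧
        (dualToKaehler Γ(V, U.opens) k (X.ideal ⟨U.opens, U.1.2⟩) (U.sec s)
          (hX.dual_mem U)).baseChange (ChartRing Γ(V, U.opens) Γ(E.sheaf, U.opens) l)
            (taut Γ(V, U.opens) b l) ∈
          J • (⊤ : Submodule (ChartRing Γ(V, U.opens) Γ(E.sheaf, U.opens) l) _) := by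
  let := sectionsAlgebra p U.opens
  rw [onSpec_hypersurfaceIdeal]
  exact (isChart_quotLin l).isSingularAlong_iff b (hX.dual_mem U) (hX U).le

theorem IsZeroScheme.tyurinaIdeal_eq_singularityIdeal {k : Type u} [CommRing k]
    (p : V ⟶ Spec (.of k)) (hX : E.IsZeroScheme s X) :
    E.tyurinaIdeal s p hX = singularityIdeal (E.π ≫ p) (E.hypersurfaceIdeal s) := by
  rw [singularityIdeal_eq_sInf E.exists_mem_range_charts fun c ↦ E.chart_comp_π_comp p c.1 c.2]
  refine congrArg sInf (Set.ext fun J ↦ ⟨fun ⟨hXJ, hJ⟩ c ↦ ?_, fun h ↦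
    ⟨(E.comap_π_le_iff X J).mpr fun U l ↦ ?_, fun U l b ↦ ?_⟩⟩)
  · exact (hX.isSingularAlong_chart_iff p (c.1.2.choose_spec.basis le_rfl) _).mpr
      ⟨(E.comap_π_le_iff X J).mp hXJ c.1 c.2, hJ c.1 c.2 _⟩
  · exact ((hX.isSingularAlong_chart_iff p (U.2.choose_spec.basis le_rfl) _).mp (h ⟨U, l⟩)).1
  · exact ((hX.isSingularAlong_chart_iff p b _).mp (h ⟨U, l⟩)).2

theorem onSpec_hypersurfaceIdeal_of_eq_sum {ι : Type*} [Fintype ι] (U : E.Patch)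
    (l : Γ(E.sheaf, U.opens)) (y : ι → Γ(E.sheaf, U.opens)) (f : ι → Γ(V, U.opens))
    (hs : U.sec s = ∑ j, f j • y j) :
    onSpec (E.hypersurfaceIdeal s) (E.chart U l) =
      Ideal.span {∑ j, f j • quot Γ(V, U.opens) l (y j)} := by
  have hquot : quotLin (A := Γ(V, U.opens)) l (∑ j, f j • y j) = ∑ j, f j • quotLin l (y j) := by
    simp only [map_sum, map_smul]
  rw [onSpec_hypersurfaceIdeal, hs]
  exact congrArg (Ideal.span {·}) hquot

end VectorBundle

end ProjBundle

theorem mainTheorem9_general {k : Type u} [CommRing k] {V : Scheme.{u}} (p : V ⟶ Spec (.of k))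
    {n : ℕ} (E : ProjBundle.VectorBundle V n) (s : Γ(E.sheaf, ⊤)) (X : V.IdealSheafData)
    (hX : E.IsZeroScheme s X) :
    E.tyurinaIdeal s p hX =
        ProjBundle.singularityIdeal (E.π ≫ p) (E.hypersurfaceIdeal s) ∧
      ∀ (U : E.Patch) {ι : Type*} [Fintype ι] (y : ι → Γ(E.sheaf, U.opens))
        (f : ι → Γ(V, U.opens)), U.sec s = ∑ j, f j • y j →
        ∀ l : Γ(E.sheaf, U.opens), ProjBundle.onSpec (E.hypersurfaceIdeal s) (E.chart U l) =
          Ideal.span {∑ j, f j • ProjBundle.quot Γ(V, U.opens) l (y j)} :=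
  ⟨hX.tyurinaIdeal_eq_singularityIdeal p, fun U _ _ y f hs l ↦
    ProjBundle.VectorBundle.onSpec_hypersurfaceIdeal_of_eq_sum U l y f hs⟩

theorem mainTheorem9 {k : Type u} [Field k] [IsAlgClosed k] [CharZero k]
    {V : Scheme.{u}} (p : V ⟶ Spec (.of k))
    [IsSeparated p] [LocallyOfFiniteType p] [QuasiCompact p] [Smooth p]
    {r : ℕ} (E : ProjBundle.VectorBundle V (r + 1)) (s : Γ(E.sheaf, ⊤))
    (X : V.IdealSheafData) (hX : E.IsZeroScheme s X) :
    E.tyurinaIdeal s p hX =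
        ProjBundle.singularityIdeal (E.π ≫ p) (E.hypersurfaceIdeal s) ∧
      ∀ (U : E.Patch) (y : Fin (r + 1) → Γ(E.sheaf, U.opens)),
        ProjBundle.IsFrame E.sheaf U.opens y →
        ∀ f : Fin (r + 1) → Γ(V, U.opens), U.sec s = ∑ j, f j • y j →
        ∀ i, ProjBundle.onSpec (E.hypersurfaceIdeal s) (E.chart U (y i)) =
          Ideal.span {∑ j, f j • ProjBundle.quot Γ(V, U.opens) (y i) (y j)} :=
  have h := mainTheorem9_general p E s X hX
  ⟨h.1, fun U y _ f hs i ↦ h.2 U y f hs (y i)⟩
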